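/- Identify $M_3(\mathbb C)\otimes M_3(\mathbb C)$ with $M_9(\mathbb C)$. A state is a positive semidefinite matrix of trace $1$ in this algebra. Let $\mathcal{AP}_{3,3}$ be the set of absolutely PPT states, i.e. the states $\rho$ such that $(\mathrm{id}\otimes T)(W\rho W^\dagger)$ is positive semidefinite for every unitary $W\in M_9(\mathbb C)$, where $T$ is the transpose map on $M_3(\mathbb C)$. A point $\rho\in\mathcal{AP}_{3,3}$ is called an interior point if $\frac1{1-\varepsilon}\left(\rho-\frac{\varepsilon}{9}I_9\right)\in\mathcal{AP}_{3,3}$ for some $\varepsilon\in(0,1)$, and a boundary point otherwise. It is called extreme if it is an extreme point of the convex set $\mathcal{AP}_{3,3}$. For $x\in\mathbb R^9$ put $$L_1(x)=\begin{bmatrix}2x_9&x_8-x_1&x_6-x_2\\ x_8-x_1&2x_7&x_5-x_3\\ x_6-x_2&x_5-x_3&2x_4\end{bmatrix},\qquad L_2(x)=\begin{bmatrix}2x_9&x_8-x_1&x_7-x_2\\ x_8-x_1&2x_6&x_5-x_3\\ x_7-x_2&x_5-x_3&2x_4\end{bmatrix}.$$ **Theorem.** Let $\rho$ be a boundary point of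 $\mathcal{AP}_{3,3}$ of full rank, with eigenvalues $\lambda_1\ge\cdots\ge\lambda_9$ (with multiplicity), and put $\lambda=(\lambda_1,\dots,\lambda_9)$. Let $U=[U_1\,U_2\,U_3]$ and $V=[V_1\,V_2\,V_3]$ be real orthogonal $3\times3$ matrices, written in columns, such that $D_1=U^TL_1(\lambda)U$ and $D_2=V^TL_2(\lambda)V$ are diagonal with diagonal entries in non-increasing order. Then $D_1$ and $D_2$ are positive semidefinite. Moreover, consider the following linear equations in $t=(t_1,\dots,t_9)\in\mathbb R^9$: (a) $\sum_{i=1}^9t_i=0$; (b) $t_k=t_{k+1}$ for every $k\in\{1,\dots,8\}$ with $\lambda_k=\lambda_{k+1}$; (c) $L_1(t)\,U_3=0$; (d) $L_2(t)\,V_3=0$. (i) If $\det L_1(\lambda)=0$ and $\det L_2(\lambda)>0$, then $\rho$ is extreme if and only if (a), (b), (c) have only the trivial solution $t=0$. (ii) If $\det L_1(\lambda)>0$ and $\det L_2(\lambda)=0$, then $\rho$ is extreme if and only if (a), (b), (d) have only the trivial solution $t=0$. (iii) If $\det L_1(\lambda)=\det L_2(\lambda)=0$, then $\rho$ is extreme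 if and only if (a), (b), (c), (d) have only the trivial solution $t=0$. -/

import Mathlib

open scoped ComplexOrder Matrix

/-- Partial transpose `(id ⊗ T)(ρ)` with respect to the second tensor factor, where
`M_m(ℂ) ⊗ M_n(ℂ)` is identified with matrices indexed by `Fin m × Fin n`. -/
def partialTranspose {m n : ℕ} (ρ : Matrix (Fin m × Fin n) (Fin m × Fin n) ℂ) :
    Matrix (Fin m × Fin n) (Fin m × Fin n) ℂ :=
  Matrix.of fun p q => ρ (p.1, q.2) (q.1, p.2)

/-- A (normalized) `m × n` quantum state: positive semidefinite with trace one. -/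
def IsState {m n : ℕ} (ρ : Matrix (Fin m × Fin n) (Fin m × Fin n) ℂ) : Prop :=
  ρ.PosSemidef ∧ ρ.trace = 1

/-- The set of absolutely PPT states: the states which have positive partial transpose after
conjugation by an arbitrary global unitary matrix. -/
def APPT (m n : ℕ) : Set (Matrix (Fin m × Fin n) (Fin m × Fin n) ℂ) :=
  {ρ | IsState ρ ∧
    ∀ W ∈ Matrix.unitaryGroup (Fin m × Fin n) ℂ, (partialTranspose (W * ρ * Wᴴ)).PosSemidef}

theorem APPT.isHermitian {m n : ℕ} {ρ : Matrix (Fin m × Fin n) (Fin m × Fin n) ℂ}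
    (h : ρ ∈ APPT m n) : ρ.IsHermitian :=
  h.1.1.isHermitian

/-- `ρ` is an interior point of the set of absolutely PPT states if it is a proper convex
combination `(1 - ε) σ + ε I / (mn)` of such a state `σ` and the maximally mixed state. -/
def IsInteriorAPPT {m n : ℕ} (ρ : Matrix (Fin m × Fin n) (Fin m × Fin n) ℂ) : Prop :=
  ∃ ε : ℝ, 0 < ε ∧ ε < 1 ∧
    (1 / (1 - ε)) • (ρ - (ε * (1 / ((m : ℝ) * (n : ℝ)))) •
      (1 : Matrix (Fin m × Fin n) (Fin m × Fin n) ℂ)) ∈ APPT m n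

/-- Boundary points: absolutely PPT states that are not interior points. -/
def IsBoundaryAPPT {m n : ℕ} (ρ : Matrix (Fin m × Fin n) (Fin m × Fin n) ℂ) : Prop :=
  ρ ∈ APPT m n ∧ ¬ IsInteriorAPPT ρ

/-- The eigenvalues `λ₁ ≥ ⋯ ≥ λ₉` (with multiplicity) of a Hermitian matrix of order nine;
the `k`-th entry, counted from zero, is `λ_{k+1}`. -/
noncomputable def eigenvalueVector
    {ρ : Matrix (Fin 3 × Fin 3) (Fin 3 × Fin 3) ℂ} (hρ : ρ.IsHermitian) : Fin 9 → ℝ :=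
  fun k => hρ.eigenvalues₀ (Fin.cast (by simp) k)

/-- The first matrix `L₁(x)` of Hildebrand's criterion. Coordinates are counted from zero, so
that `x k` is the coordinate `x_{k+1}`. -/
def hildebrandL1 (x : Fin 9 → ℝ) : Matrix (Fin 3) (Fin 3) ℝ :=
  !![2 * x 8,   x 7 - x 0, x 5 - x 1;
     x 7 - x 0, 2 * x 6,   x 4 - x 2;
     x 5 - x 1, x 4 - x 2, 2 * x 3]

/-- The second matrix `L₂(x)` of Hildebrand's criterion (coordinates counted from zero). -/
def hildebrandL2 (x : Fin 9 → ℝ) : Matrix (Fin 3) (Fin 3) ℝ :=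
  !![2 * x 8,   x 7 - x 0, x 6 - x 1;
     x 7 - x 0, 2 * x 5,   x 4 - x 2;
     x 6 - x 1, x 4 - x 2, 2 * x 3]

/-- The linear conditions `∑ tᵢ = 0` and `t_k = t_{k+1}` whenever `λ_k = λ_{k+1}`. -/
def SumZeroAndTies (lam t : Fin 9 → ℝ) : Prop :=
  ∑ i, t i = 0 ∧ ∀ k : Fin 8, lam k.castSucc = lam k.succ → t k.castSucc = t k.succ

/-!
# Extreme points among the full rank boundary points of the absolutely PPT states

By the Schmidt decomposition, a vector of `ℂ³ ⊗ ℂ³` is unitarily equivalent, by local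
unitaries, to `∑ s a • e_a ⊗ e_a`, and the partial transpose of the rank one matrix of the latter has
the eigenvalues `s a * s b` for `a ≤ b` and `-(s a * s b)` for `b < a`, with eigenvectors
`e_a ⊗ e_a` and `(e_a ⊗ e_b ± e_b ⊗ e_a) / √2`. Hence `σ` is absolutely PPT if and only if
`∑ p, schmidtSpectrum s p * y p ≥ 0` for all `s`, where `y = diagVec Q σ` is the diagonal of `σ` in
any orthonormal basis `Q`. For fixed `y` this sum is half the quadratic form in `s` of
`pairMatrix y`, and `L₁`, `L₂` are `pairMatrix` of two arrangements of the eigenvalues. Necessity of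
`pairMatrix y ≥ 0` in *every* basis is `APPT.posSemidef_pairMatrix_diagVec`. Conversely, Birkhoff's
theorem and the rearrangement inequality show that for each ordered `s` the minimum over all bases
is attained at one of the two arrangements (`mem_APPT_of_posSemidef_hildebrand`).

*Extreme points admit no direction `t`.* The off-diagonal entries of `L₁`, `L₂` are nonpositive and
the diagonal ones positive, so both have rank at least two. A direction `t` with `L₁(t) U₃ = 0` thus
preserves `L₁ ≥ 0` to both sides of `λ` for small parameters, and so on for `L₂`
(`PairOrdered.eventually_posSemidef`); the tie conditions keep the eigenvalues ordered, and `ρ` is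
the midpoint of two absolutely PPT states (`eq_zero_of_mem_extremePoints`).

*Non-extreme points admit one.* Let `ρ` lie in the open segment from `σ` to `τ`, and let `s` be a
kernel vector of `L₁` or `L₂`. Positivity for `σ` and `τ` gives
`pairMatrix (diagVec Q σ) *ᵥ s = 0` for all bases `Q` in which `ρ` has this property. Rotating an
eigenbasis of `ρ` in the plane of two of its vectors changes the diagonal of a matrix by a multiple
of `Pi.single p 1 - Pi.single q 1`. Hence `σ` has no off-diagonal entry at `p`, `q`, and equal
diagonal entries if the eigenvalues agree, provided that `pairMatrix` of that difference does not
annihilate `s` (`apply_eq_zero_of_pairMatrix_single_sub_single_ne_zero`). The proviso fails only for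
`s` proportional to `(1, 1, 0)`; then the eigenvalues involved agree with a third one, to which `p`
and `q` can be compared (`PairOrdered.exchange`). So `σ` is diagonal in the eigenbasis of `ρ`, and
the differences of the diagonal entries form the direction `t`, which is nonzero if `σ ≠ ρ`.
-/

/-! ### The quadratic form of a partial transpose -/

/-- The spectrum of the partial transpose of the rank one matrix `ψψᴴ`, `ψ = ∑ s a • e_a ⊗ e_a`,
indexed by the pairs `(a, b)`. The symmetric vectors carry the pairs with `a ≤ b`, the
antisymmetric ones the pairs with `b < a`. -/
def schmidtSpectrum (s : Fin 3 → ℝ) (p : Fin 3 × Fin 3) : ℝ :=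
  if p.1 ≤ p.2 then s p.1 * s p.2 else -(s p.1 * s p.2)

/-- The symmetric matrix of the quadratic form `s ↦ 2 ∑ schmidtSpectrum s p * y p`. -/
def pairMatrix (y : Fin 3 × Fin 3 → ℝ) : Matrix (Fin 3) (Fin 3) ℝ :=
  !![2 * y (0, 0), y (0, 1) - y (1, 0), y (0, 2) - y (2, 0);
     y (0, 1) - y (1, 0), 2 * y (1, 1), y (1, 2) - y (2, 1);
     y (0, 2) - y (2, 0), y (1, 2) - y (2, 1), 2 * y (2, 2)]

/-- The diagonal of `σ` in the orthonormal basis given by the columns of `Q`. -/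
def diagVec (Q σ : Matrix (Fin 3 × Fin 3) (Fin 3 × Fin 3) ℂ) (p : Fin 3 × Fin 3) : ℝ :=
  ((Qᴴ * σ * Q) p p).re

/-- The orthogonal change of basis from the product basis to the basis of the vectors `e_a ⊗ e_a`
and `(e_a ⊗ e_b ± e_b ⊗ e_a) / √2`. -/
noncomputable def bellMatrix : Matrix (Fin 3 × Fin 3) (Fin 3 × Fin 3) ℂ :=
  Matrix.of fun p q =>
    if p = q then
      (if p.1 = p.2 then 1 else if p.1 < p.2 then ((√2)⁻¹ : ℝ) else -((√2)⁻¹ : ℝ))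
    else if p = q.swap then ((√2)⁻¹ : ℝ) else 0

/-- The partial transpose of the rank one matrix of `∑ s a • e_a ⊗ e_a`. -/
def schmidtSwap (s : Fin 3 → ℝ) : Matrix (Fin 3 × Fin 3) (Fin 3 × Fin 3) ℂ :=
  Matrix.of fun p q => if p = q.swap then ((s p.1 * s p.2 : ℝ) : ℂ) else 0

theorem bellMatrix_isHermitian : bellMatrixᴴ = bellMatrix := by
  ext ⟨a, b⟩ ⟨c, d⟩
  fin_cases a <;> fin_cases b <;> fin_cases c <;> fin_cases d <;>
    simp [bellMatrix, Matrix.conjTranspose_apply]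

theorem inv_sqrt_two_mul_self : (((√2)⁻¹ : ℝ) : ℂ) * (((√2)⁻¹ : ℝ) : ℂ) = 1 / 2 := by
  rw [← Complex.ofReal_mul, ← mul_inv, Real.mul_self_sqrt (by norm_num)]
  norm_num

theorem bellMatrix_mul_self : bellMatrix * bellMatrix = 1 := by
  have h := inv_sqrt_two_mul_self
  generalize hr : (((√2)⁻¹ : ℝ) : ℂ) = r at h
  have h' : r * r + r * r = 1 := by rw [h]; norm_num
  ext ⟨a, b⟩ ⟨c, d⟩
  fin_cases a <;> fin_cases b <;> fin_cases c <;> fin_cases d <;>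
    simp [bellMatrix, Matrix.mul_apply, Fintype.sum_prod_type, Fin.sum_univ_three,
      hr, h', -Complex.ofReal_inv]

set_option maxHeartbeats 1000000 in
theorem schmidtSwap_mul_bellMatrix (s : Fin 3 → ℝ) :
    schmidtSwap s * bellMatrix =
      bellMatrix * Matrix.diagonal (fun p => (schmidtSpectrum s p : ℂ)) := by
  generalize hr : (((√2)⁻¹ : ℝ) : ℂ) = r
  ext ⟨a, b⟩ ⟨c, d⟩
  rw [Matrix.mul_diagonal]
  fin_cases a <;> fin_cases b <;> fin_cases c <;> fin_cases d <;>
    simp [bellMatrix, schmidtSwap, schmidtSpectrum, Matrix.mul_apply, Fintype.sum_prod_type,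
      Fin.sum_univ_three, hr, mul_comm, -Complex.ofReal_inv]

theorem bellMatrix_mem_unitaryGroup :
    bellMatrix ∈ Matrix.unitaryGroup (Fin 3 × Fin 3) ℂ := by
  rw [Matrix.mem_unitaryGroup_iff, Matrix.star_eq_conjTranspose, bellMatrix_isHermitian,
    bellMatrix_mul_self]

theorem sum_mul_swap_apply (s : Fin 3 → ℝ) (M : Matrix (Fin 3 × Fin 3) (Fin 3 × Fin 3) ℂ) :
    ∑ a, ∑ b, (s a : ℂ) * s b * M (a, b) (b, a) =
      ∑ p, (schmidtSpectrum s p : ℂ) * (bellMatrix * M * bellMatrix) p p := by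
  have h1 : ∑ a, ∑ b, (s a : ℂ) * s b * M (a, b) (b, a) = (schmidtSwap s * M).trace := by
    simp only [Matrix.trace, Matrix.diag_apply, Matrix.mul_apply, Fintype.sum_prod_type,
      schmidtSwap, Matrix.of_apply, Fin.sum_univ_three]
    simp
    ring
  have h2 : schmidtSwap s =
      bellMatrix * Matrix.diagonal (fun p => (schmidtSpectrum s p : ℂ)) * bellMatrix := by
    rw [← schmidtSwap_mul_bellMatrix, Matrix.mul_assoc, bellMatrix_mul_self, Matrix.mul_one]
  rw [h1, h2, Matrix.mul_assoc, Matrix.mul_assoc, Matrix.trace_mul_comm, Matrix.mul_assoc,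
    Matrix.trace]
  simp [Matrix.mul_assoc]

theorem dotProduct_pairMatrix_mulVec (y : Fin 3 × Fin 3 → ℝ) (s : Fin 3 → ℝ) :
    s ⬝ᵥ (pairMatrix y *ᵥ s) = 2 * ∑ p, schmidtSpectrum s p * y p := by
  simp [pairMatrix, schmidtSpectrum, Matrix.mulVec, dotProduct, Fintype.sum_prod_type,
    Fin.sum_univ_three]
  ring

theorem ofReal_diagVec {Q σ : Matrix (Fin 3 × Fin 3) (Fin 3 × Fin 3) ℂ} (hσ : σ.IsHermitian)
    (p : Fin 3 × Fin 3) : (diagVec Q σ p : ℂ) = (Qᴴ * σ * Q) p p := by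
  have h : (Qᴴ * σ * Q).IsHermitian := Matrix.isHermitian_conjTranspose_mul_mul Q hσ
  exact h.coe_re_apply_self p

/-- The Schmidt vector `∑ s a • e_a ⊗ e_a`, rotated by a unitary, tests the partial transposes of
an absolutely PPT state in any orthonormal basis. -/
theorem APPT.sum_schmidtSpectrum_mul_diagVec_nonneg
    {σ : Matrix (Fin 3 × Fin 3) (Fin 3 × Fin 3) ℂ} (hσ : σ ∈ APPT 3 3)
    {Q : Matrix (Fin 3 × Fin 3) (Fin 3 × Fin 3) ℂ} (hQ : Q ∈ Matrix.unitaryGroup _ ℂ)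
    (s : Fin 3 → ℝ) : 0 ≤ ∑ p, schmidtSpectrum s p * diagVec Q σ p := by
  have hW : bellMatrix * Qᴴ ∈ Matrix.unitaryGroup (Fin 3 × Fin 3) ℂ :=
    mul_mem bellMatrix_mem_unitaryGroup (Unitary.star_mem hQ)
  have hpsd := hσ.2 _ hW
  have h := (Matrix.posSemidef_iff_dotProduct_mulVec.1 hpsd).2
    (fun p => if p.1 = p.2 then (s p.1 : ℂ) else 0)
  have hcalc : star (fun p : Fin 3 × Fin 3 => if p.1 = p.2 then (s p.1 : ℂ) else 0) ⬝ᵥ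
      (partialTranspose (bellMatrix * Qᴴ * σ * (bellMatrix * Qᴴ)ᴴ) *ᵥ
        (fun p => if p.1 = p.2 then (s p.1 : ℂ) else 0)) =
      ((∑ p, schmidtSpectrum s p * diagVec Q σ p : ℝ) : ℂ) := by
    push_cast
    simp only [ofReal_diagVec (APPT.isHermitian hσ)]
    have e : Qᴴ * σ * Q = bellMatrix * (bellMatrix * Qᴴ * σ * (bellMatrix * Qᴴ)ᴴ) * bellMatrix := by
      rw [Matrix.conjTranspose_mul, Matrix.conjTranspose_conjTranspose, bellMatrix_isHermitian]
      calc Qᴴ * σ * Q = (bellMatrix * bellMatrix) * Qᴴ * σ * Q * (bellMatrix * bellMatrix) := by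
            simp [bellMatrix_mul_self]
        _ = _ := by simp only [Matrix.mul_assoc]
    rw [e, ← sum_mul_swap_apply]
    simp only [Matrix.mulVec, dotProduct, Fintype.sum_prod_type, Fin.sum_univ_three]
    simp [partialTranspose]
    ring
  rw [hcalc] at h
  exact_mod_cast h

theorem pairMatrix_isHermitian (y : Fin 3 × Fin 3 → ℝ) : (pairMatrix y).IsHermitian := by
  ext a b
  fin_cases a <;> fin_cases b <;> simp [pairMatrix]

theorem APPT.posSemidef_pairMatrix_diagVec
    {σ : Matrix (Fin 3 × Fin 3) (Fin 3 × Fin 3) ℂ} (hσ : σ ∈ APPT 3 3)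
    {Q : Matrix (Fin 3 × Fin 3) (Fin 3 × Fin 3) ℂ} (hQ : Q ∈ Matrix.unitaryGroup _ ℂ) :
    (pairMatrix (diagVec Q σ)).PosSemidef := by
  refine Matrix.posSemidef_iff_dotProduct_mulVec.2 ⟨pairMatrix_isHermitian _, fun s => ?_⟩
  rw [star_trivial, dotProduct_pairMatrix_mulVec]
  have := APPT.sum_schmidtSpectrum_mul_diagVec_nonneg hσ hQ s
  positivity

/-! ### Unitary matrices and singular values -/

theorem Matrix.submatrix_mem_unitaryGroup {ι : Type*} [Fintype ι] [DecidableEq ι]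
    {Q : Matrix ι ι ℂ} (hQ : Q ∈ Matrix.unitaryGroup ι ℂ) (e : ι ≃ ι) :
    Q.submatrix id e ∈ Matrix.unitaryGroup ι ℂ := by
  rw [Matrix.mem_unitaryGroup_iff', Matrix.star_eq_conjTranspose] at hQ ⊢
  rw [Matrix.conjTranspose_submatrix, ← Matrix.submatrix_mul _ _ _ _ _ Function.bijective_id, hQ,
    Matrix.submatrix_one_equiv]

/-- Unitary diagonalization with the eigenvalues listed in any prescribed order. -/
theorem Matrix.IsHermitian.exists_unitary_eq_diagonal_comp {ι : Type*} [Fintype ι] [DecidableEq ι]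
    {A : Matrix ι ι ℂ} (hA : A.IsHermitian) (e : ι ≃ Fin (Fintype.card ι)) :
    ∃ Q ∈ Matrix.unitaryGroup ι ℂ,
      Qᴴ * A * Q = Matrix.diagonal fun i => (hA.eigenvalues₀ (e i) : ℂ) := by
  set E : Fin (Fintype.card ι) ≃ ι := Fintype.equivOfCardEq (Fintype.card_fin _) with hE
  refine ⟨(hA.eigenvectorUnitary : Matrix ι ι ℂ).submatrix id (e.trans E),
    Matrix.submatrix_mem_unitaryGroup hA.eigenvectorUnitary.2 _, ?_⟩
  have h := hA.conjStarAlgAut_star_eigenvectorUnitary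
  rw [Unitary.conjStarAlgAut_star_apply, Matrix.star_eq_conjTranspose] at h
  have h2 : (((hA.eigenvectorUnitary : Matrix ι ι ℂ).submatrix id (e.trans E))ᴴ * A *
      (hA.eigenvectorUnitary : Matrix ι ι ℂ).submatrix id (e.trans E)) =
      ((hA.eigenvectorUnitary : Matrix ι ι ℂ)ᴴ * A *
        (hA.eigenvectorUnitary : Matrix ι ι ℂ)).submatrix (e.trans E) (e.trans E) := by
    ext i j
    simp [Matrix.mul_apply]
  rw [h2, h]
  ext i j
  by_cases hij : i = j
  · subst hij
    simp [Matrix.IsHermitian.eigenvalues, ← hE]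
  · simp [hij]

theorem Matrix.IsHermitian.exists_unitary_conj_eq_diagonal_antitone {n : ℕ}
    {A : Matrix (Fin n) (Fin n) ℂ} (hA : A.IsHermitian) :
    ∃ Q ∈ Matrix.unitaryGroup (Fin n) ℂ, ∃ d : Fin n → ℝ, Antitone d ∧
      Qᴴ * A * Q = Matrix.diagonal fun i => (d i : ℂ) := by
  obtain ⟨Q, hQ, h⟩ := hA.exists_unitary_eq_diagonal_comp (finCongr (Fintype.card_fin n).symm)
  refine ⟨Q, hQ, _, ?_, h⟩
  intro i j hij
  exact hA.eigenvalues₀_antitone (by simpa using hij)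

/-- Singular value decomposition of a square matrix, with ordered singular values. -/
theorem Matrix.exists_singularValueDecomposition {n : ℕ} (M : Matrix (Fin n) (Fin n) ℂ) :
    ∃ A ∈ Matrix.unitaryGroup (Fin n) ℂ, ∃ V ∈ Matrix.unitaryGroup (Fin n) ℂ,
      ∃ s : Fin n → ℝ, Antitone s ∧ (∀ i, 0 ≤ s i) ∧
        M = A * Matrix.diagonal (fun i => (s i : ℂ)) * Vᴴ := by
  obtain ⟨V, hV, d, hd, h⟩ :=
    (Matrix.isHermitian_conjTranspose_mul_self M).exists_unitary_conj_eq_diagonal_antitone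
  have hN : (M * V)ᴴ * (M * V) = Matrix.diagonal fun i => (d i : ℂ) := by
    rw [← h, Matrix.conjTranspose_mul]; simp only [Matrix.mul_assoc]
  have hd0 : ∀ i, 0 ≤ d i := by
    have := Matrix.posSemidef_conjTranspose_mul_self (M * V)
    rw [hN, Matrix.posSemidef_diagonal_iff] at this
    intro i
    exact_mod_cast this i
  have hentry : ∀ i j, ∑ k, star ((M * V) k i) * (M * V) k j =
      if i = j then (d i : ℂ) else 0 := by
    intro i j
    have := congrFun (congrFun hN i) j
    rw [Matrix.mul_apply, Matrix.diagonal_apply] at this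
    simpa only [Matrix.conjTranspose_apply] using this
  -- The columns of `M * V` are orthogonal; those of nonzero length are normalized and completed.
  set v : Fin n → EuclideanSpace ℂ (Fin n) := fun i =>
    WithLp.toLp 2 fun k => ((√(d i))⁻¹ : ℂ) * (M * V) k i with hv
  have hon : Orthonormal ℂ (Set.domRestrict {i | d i ≠ 0} v) := by
    rw [orthonormal_iff_ite]
    rintro ⟨i, hi⟩ ⟨j, hj⟩
    have hi' : (√(d i) : ℂ) * √(d i) = d i := by
      rw [← Complex.ofReal_mul, Real.mul_self_sqrt (hd0 i)]
    have hi0 : (√(d i) : ℂ) ≠ 0 := by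
      simpa using (Real.sqrt_ne_zero (hd0 i)).2 hi
    have : inner ℂ (v i) (v j) = ((√(d i))⁻¹ : ℂ) * ((√(d j))⁻¹ : ℂ) *
        ∑ k, star ((M * V) k i) * (M * V) k j := by
      rw [PiLp.inner_apply, Finset.mul_sum]
      refine Finset.sum_congr rfl fun k _ => ?_
      simp [hv]
      ring
    simp only [Set.domRestrict_apply, this, hentry, Subtype.mk.injEq]
    by_cases hij : i = j
    · subst hij
      simp only [if_true, ← hi']
      field_simp
    · simp [hij]
  obtain ⟨b, hb⟩ := hon.exists_orthonormalBasis_extension_of_card_eq (by simp)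
  refine ⟨(EuclideanSpace.basisFun (Fin n) ℂ).toBasis.toMatrix b.toBasis,
    (EuclideanSpace.basisFun (Fin n) ℂ).toMatrix_orthonormalBasis_mem_unitary b, V, hV,
    fun i => √(d i), fun i j hij => Real.sqrt_le_sqrt (hd hij), fun i => Real.sqrt_nonneg _, ?_⟩
  have key : M * V = (EuclideanSpace.basisFun (Fin n) ℂ).toBasis.toMatrix b.toBasis *
      Matrix.diagonal (fun i => (√(d i) : ℂ)) := by
    ext k i
    rw [Matrix.mul_diagonal]
    have hA : (EuclideanSpace.basisFun (Fin n) ℂ).toBasis.toMatrix b.toBasis k i = b i k := rfl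
    rw [hA]
    by_cases hi : d i = 0
    · have hz := hentry i i
      simp only [if_true, hi, Complex.ofReal_zero] at hz
      have : ∀ k, (M * V) k i = 0 := by
        have h3 : ∑ k, ((Complex.normSq ((M * V) k i) : ℝ) : ℂ) = 0 := by
          rw [← hz]
          refine Finset.sum_congr rfl fun k _ => ?_
          rw [Complex.normSq_eq_conj_mul_self]; rfl
        have h4 : ∑ k, Complex.normSq ((M * V) k i) = 0 := by exact_mod_cast h3
        rw [Finset.sum_eq_zero_iff_of_nonneg fun _ _ => Complex.normSq_nonneg _] at h4
        intro k
        exact Complex.normSq_eq_zero.1 (h4 k (Finset.mem_univ _))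
      simp [this, hi]
    · have hi0 : (√(d i) : ℂ) ≠ 0 := by
        simpa using (Real.sqrt_ne_zero (hd0 i)).2 hi
      rw [hb i hi]
      simp only [hv]
      field_simp
  rw [← key, Matrix.mul_assoc]
  have hVV : V * Vᴴ = 1 := Matrix.mem_unitaryGroup_iff.1 hV
  rw [hVV, Matrix.mul_one]

/-! ### The trace inequality for commuting arrangements -/

/-- The rearrangement inequality averaged over permutations by Birkhoff's theorem. -/
theorem Antivary.sum_mul_le_sum_mul_doublyStochastic {ι : Type*} [Fintype ι] [DecidableEq ι]
    {f g : ι → ℝ} (hfg : Antivary f g) {D : Matrix ι ι ℝ} (hD : D ∈ doublyStochastic ℝ ι) :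
    ∑ i, f i * g i ≤ ∑ i, f i * (D *ᵥ g) i := by
  obtain ⟨w, hw0, hw1, rfl⟩ := exists_eq_sum_perm_of_mem_doublyStochastic hD
  have h : ∑ i, f i * ((∑ σ, w σ • σ.permMatrix ℝ) *ᵥ g) i =
      ∑ σ : Equiv.Perm ι, w σ * ∑ i, f i * g (σ i) := by
    simp only [Matrix.sum_mulVec, Matrix.smul_mulVec, Matrix.permMatrix_mulVec, Finset.sum_apply,
      Pi.smul_apply, Function.comp_apply, smul_eq_mul, Finset.mul_sum]
    rw [Finset.sum_comm]
    refine Finset.sum_congr rfl fun σ _ => Finset.sum_congr rfl fun i _ => by ring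
  rw [h]
  calc ∑ i, f i * g i = ∑ σ : Equiv.Perm ι, w σ * ∑ i, f i * g i := by
        rw [← Finset.sum_mul, hw1, one_mul]
    _ ≤ _ := Finset.sum_le_sum fun σ _ =>
        mul_le_mul_of_nonneg_left hfg.sum_mul_le_sum_mul_comp_perm (hw0 σ)

/-- The squared moduli of the entries of a unitary matrix. -/
theorem Matrix.normSq_mem_doublyStochastic {ι : Type*} [Fintype ι] [DecidableEq ι]
    {Q : Matrix ι ι ℂ} (hQ : Q ∈ Matrix.unitaryGroup ι ℂ) :
    (Matrix.of fun i j => Complex.normSq (Q i j)) ∈ doublyStochastic ℝ ι := by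
  rw [mem_doublyStochastic_iff_sum]
  refine ⟨fun i j => Complex.normSq_nonneg _, fun i => ?_, fun j => ?_⟩
  · have h := congrFun (congrFun (Matrix.mem_unitaryGroup_iff.1 hQ) i) i
    rw [Matrix.mul_apply, Matrix.one_apply_eq] at h
    have h' : ((∑ j, Complex.normSq (Q i j) : ℝ) : ℂ) = 1 := by
      rw [← h]; push_cast
      exact Finset.sum_congr rfl fun k _ => (Complex.mul_conj _).symm
    exact_mod_cast h'
  · have h := congrFun (congrFun (Matrix.mem_unitaryGroup_iff'.1 hQ) j) j
    rw [Matrix.mul_apply, Matrix.one_apply_eq] at h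
    have h' : ((∑ i, Complex.normSq (Q i j) : ℝ) : ℂ) = 1 := by
      rw [← h]; push_cast
      exact Finset.sum_congr rfl fun k _ => Complex.normSq_eq_conj_mul_self
    exact_mod_cast h'

/-! ### Sufficiency of Hildebrand's criterion -/

theorem partialTranspose_isHermitian {m n : ℕ}
    {σ : Matrix (Fin m × Fin n) (Fin m × Fin n) ℂ} (hσ : σ.IsHermitian) :
    (partialTranspose σ).IsHermitian := by
  ext p q
  simpa [partialTranspose] using hσ.apply (p.1, q.2) (q.1, p.2)

open scoped Kronecker in
/-- In a Schmidt basis of the vector `ψ`, the expectation of the partial transpose at `ψ` only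
involves the entries `((a, b), (b, a))`. -/
theorem star_dotProduct_partialTranspose_mulVec
    (σ : Matrix (Fin 3 × Fin 3) (Fin 3 × Fin 3) ℂ) (A V : Matrix (Fin 3) (Fin 3) ℂ)
    (s : Fin 3 → ℝ) (ψ : Fin 3 × Fin 3 → ℂ)
    (hψ : ∀ i j, ψ (i, j) = (A * Matrix.diagonal (fun i => (s i : ℂ)) * Vᴴ) i j) :
    star ψ ⬝ᵥ (partialTranspose σ *ᵥ ψ) =
      ∑ a, ∑ b, (s a : ℂ) * s b * ((A ⊗ₖ V)ᴴ * σ * (A ⊗ₖ V)) (a, b) (b, a) := by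
  have hψ' : ∀ i j, ψ (i, j) = ∑ a, A i a * s a * star (V j a) := by
    intro i j
    rw [hψ, Matrix.mul_apply]
    simp [Matrix.mul_diagonal]
  have hl : star ψ ⬝ᵥ (partialTranspose σ *ᵥ ψ) =
      ∑ x : (Fin 3 × Fin 3) × (Fin 3 × Fin 3) × (Fin 3 × Fin 3),
        star (A x.1.1 x.2.2.1 * s x.2.2.1 * star (V x.1.2 x.2.2.1)) *
          (σ (x.1.1, x.2.1.2) (x.2.1.1, x.1.2) *
            (A x.2.1.1 x.2.2.2 * s x.2.2.2 * star (V x.2.1.2 x.2.2.2))) := by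
    rw [Fintype.sum_prod_type]
    refine Finset.sum_congr rfl fun p _ => ?_
    rw [Fintype.sum_prod_type, Matrix.mulVec, dotProduct, Finset.mul_sum]
    refine Finset.sum_congr rfl fun q _ => ?_
    rw [Fintype.sum_prod_type, Pi.star_apply, hψ' p.1 p.2, hψ' q.1 q.2, star_sum, Finset.sum_mul]
    refine Finset.sum_congr rfl fun a _ => ?_
    rw [Finset.mul_sum, Finset.mul_sum]
    refine Finset.sum_congr rfl fun b _ => ?_
    simp [partialTranspose]
  have hr : ∑ a, ∑ b, (s a : ℂ) * s b * ((A ⊗ₖ V)ᴴ * σ * (A ⊗ₖ V)) (a, b) (b, a) =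
      ∑ x : (Fin 3 × Fin 3) × (Fin 3 × Fin 3) × (Fin 3 × Fin 3),
        (s x.1.1 : ℂ) * s x.1.2 * (star (A x.2.2.1 x.1.1 * V x.2.2.2 x.1.2) * σ x.2.2 x.2.1 *
          (A x.2.1.1 x.1.2 * V x.2.1.2 x.1.1)) := by
    rw [Fintype.sum_prod_type, Fintype.sum_prod_type]
    refine Finset.sum_congr rfl fun a _ => Finset.sum_congr rfl fun b _ => ?_
    rw [Fintype.sum_prod_type, Matrix.mul_apply, Finset.mul_sum]
    refine Finset.sum_congr rfl fun q _ => ?_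
    rw [Matrix.mul_apply, Finset.sum_mul, Finset.mul_sum]
    rfl
  rw [hl, hr]
  refine Fintype.sum_equiv
    { toFun := fun x => ((x.2.2.1, x.2.2.2), (x.2.1.1, x.1.2), (x.1.1, x.2.1.2))
      invFun := fun x => ((x.2.2.1, x.2.1.2), (x.2.1.1, x.2.2.2), (x.1.1, x.1.2))
      left_inv := fun x => rfl
      right_inv := fun x => rfl } _ _ fun x => ?_
  simp
  ring

open scoped Kronecker in
/-- The Schmidt decomposition of the test vector reduces positivity of all the partial transposes
to sums over orthonormal bases. -/
theorem mem_APPT_of_sum_schmidtSpectrum_nonneg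
    {σ : Matrix (Fin 3 × Fin 3) (Fin 3 × Fin 3) ℂ} (hσ : IsState σ)
    (h : ∀ Q ∈ Matrix.unitaryGroup (Fin 3 × Fin 3) ℂ, ∀ s : Fin 3 → ℝ, Antitone s →
      (∀ i, 0 ≤ s i) → 0 ≤ ∑ p, schmidtSpectrum s p * diagVec Q σ p) : σ ∈ APPT 3 3 := by
  refine ⟨hσ, fun W hW => ?_⟩
  have hh : (W * σ * Wᴴ).IsHermitian := Matrix.isHermitian_mul_mul_conjTranspose W hσ.1.isHermitian
  refine Matrix.posSemidef_iff_dotProduct_mulVec.2 ⟨partialTranspose_isHermitian hh, fun ψ => ?_⟩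
  obtain ⟨A, hA, V, hV, s, hs, hs0, hM⟩ :=
    Matrix.exists_singularValueDecomposition (Matrix.of fun i j => ψ (i, j))
  rw [star_dotProduct_partialTranspose_mulVec _ A V s ψ
    (fun i j => congrFun (congrFun hM i) j), sum_mul_swap_apply]
  have hQ : Wᴴ * (A ⊗ₖ V) * bellMatrix ∈ Matrix.unitaryGroup (Fin 3 × Fin 3) ℂ :=
    mul_mem (mul_mem (Unitary.star_mem hW) (Matrix.kronecker_mem_unitary hA hV))
      bellMatrix_mem_unitaryGroup
  have e : bellMatrix * ((A ⊗ₖ V)ᴴ * (W * σ * Wᴴ) * (A ⊗ₖ V)) * bellMatrix =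
      (Wᴴ * (A ⊗ₖ V) * bellMatrix)ᴴ * σ * (Wᴴ * (A ⊗ₖ V) * bellMatrix) := by
    simp only [Matrix.conjTranspose_mul, Matrix.conjTranspose_conjTranspose,
      bellMatrix_isHermitian, Matrix.mul_assoc]
  rw [e]
  have := h _ hQ s hs hs0
  simp only [← ofReal_diagVec hσ.1.isHermitian]
  exact_mod_cast this

theorem diagVec_conj_diagonal {Q R : Matrix (Fin 3 × Fin 3) (Fin 3 × Fin 3) ℂ}
    (y : Fin 3 × Fin 3 → ℝ) :
    diagVec Q (R * Matrix.diagonal (fun p => (y p : ℂ)) * Rᴴ) =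
      (Matrix.of fun p q => Complex.normSq ((Rᴴ * Q) q p)) *ᵥ y := by
  funext p
  have e : Qᴴ * (R * Matrix.diagonal (fun p => (y p : ℂ)) * Rᴴ) * Q =
      (Rᴴ * Q)ᴴ * Matrix.diagonal (fun p => (y p : ℂ)) * (Rᴴ * Q) := by
    simp only [Matrix.conjTranspose_mul, Matrix.conjTranspose_conjTranspose, Matrix.mul_assoc]
  rw [diagVec, e, Matrix.mul_apply, Complex.re_sum, Matrix.mulVec, dotProduct]
  refine Finset.sum_congr rfl fun q _ => ?_
  rw [Matrix.mul_diagonal, Matrix.conjTranspose_apply, Matrix.of_apply, Complex.normSq_apply]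
  simp only [Complex.star_def, Complex.mul_re, Complex.conj_re, Complex.conj_im, Complex.ofReal_re,
    Complex.ofReal_im, Complex.mul_im]
  ring

theorem sum_schmidtSpectrum_mul_le_diagVec {Q R : Matrix (Fin 3 × Fin 3) (Fin 3 × Fin 3) ℂ}
    (hQ : Q ∈ Matrix.unitaryGroup _ ℂ) (hR : R ∈ Matrix.unitaryGroup _ ℂ)
    {y : Fin 3 × Fin 3 → ℝ} {s : Fin 3 → ℝ} (h : Antivary (schmidtSpectrum s) y) :
    ∑ p, schmidtSpectrum s p * y p ≤ ∑ p, schmidtSpectrum s p *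
      diagVec Q (R * Matrix.diagonal (fun p => (y p : ℂ)) * Rᴴ) p := by
  rw [diagVec_conj_diagonal]
  refine h.sum_mul_le_sum_mul_doublyStochastic ?_
  exact transpose_mem_doublyStochastic_iff.2 (Matrix.normSq_mem_doublyStochastic
    (mul_mem (Unitary.star_mem hR) hQ))

/-- The position of the pair `(a, b)` in the increasing order of `schmidtSpectrum s` when
`s 0 ≥ s 1 ≥ s 2 ≥ 0` and `s 0 * s 2 ≤ s 1 ^ 2`. -/
def pairIndex₁ : Fin 3 × Fin 3 ≃ Fin 9 where
  toFun p := !![8, 7, 5; 0, 6, 4; 1, 2, 3] p.1 p.2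
  invFun := ![(1, 0), (2, 0), (2, 1), (2, 2), (1, 2), (0, 2), (1, 1), (0, 1), (0, 0)]
  left_inv := by decide
  right_inv := by decide

/-- The position of the pair `(a, b)` in the increasing order of `schmidtSpectrum s` when
`s 0 ≥ s 1 ≥ s 2 ≥ 0` and `s 1 ^ 2 ≤ s 0 * s 2`. -/
def pairIndex₂ : Fin 3 × Fin 3 ≃ Fin 9 where
  toFun p := !![8, 7, 6; 0, 5, 4; 1, 2, 3] p.1 p.2
  invFun := ![(1, 0), (2, 0), (2, 1), (2, 2), (1, 2), (1, 1), (0, 2), (0, 1), (0, 0)]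
  left_inv := by decide
  right_inv := by decide

theorem hildebrandL1_eq_pairMatrix (x : Fin 9 → ℝ) :
    hildebrandL1 x = pairMatrix (x ∘ pairIndex₁) := by
  ext a b
  fin_cases a <;> fin_cases b <;> rfl

theorem hildebrandL2_eq_pairMatrix (x : Fin 9 → ℝ) :
    hildebrandL2 x = pairMatrix (x ∘ pairIndex₂) := by
  ext a b
  fin_cases a <;> fin_cases b <;> rfl

theorem antivary_comp_of_monotone {ι : Type*} {n : ℕ} {f : ι → ℝ} {x : Fin n → ℝ} (e : ι ≃ Fin n)
    (hf : Monotone (f ∘ e.symm)) (hx : Antitone x) : Antivary f (x ∘ e) := by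
  intro p q hpq
  by_contra! hlt
  have : e q ≤ e p := by
    by_contra! hle
    exact (hx hle.le).not_gt hpq
  exact hlt.not_ge (by simpa using hf this)

theorem monotone_schmidtSpectrum_comp_pairIndex₁ {s : Fin 3 → ℝ} (hs : Antitone s)
    (h0 : ∀ i, 0 ≤ s i) (h : s 0 * s 2 ≤ s 1 * s 1) :
    Monotone (schmidtSpectrum s ∘ pairIndex₁.symm) := by
  have h01 : s 1 ≤ s 0 := hs (by decide)
  have h12 : s 2 ≤ s 1 := hs (by decide)
  have p0 := h0 0
  have p1 := h0 1
  have p2 := h0 2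
  rw [Fin.monotone_iff_le_succ]
  intro i
  fin_cases i <;> simp [schmidtSpectrum, pairIndex₁] <;> nlinarith

theorem monotone_schmidtSpectrum_comp_pairIndex₂ {s : Fin 3 → ℝ} (hs : Antitone s)
    (h0 : ∀ i, 0 ≤ s i) (h : s 1 * s 1 ≤ s 0 * s 2) :
    Monotone (schmidtSpectrum s ∘ pairIndex₂.symm) := by
  have h01 : s 1 ≤ s 0 := hs (by decide)
  have h12 : s 2 ≤ s 1 := hs (by decide)
  have p0 := h0 0
  have p1 := h0 1
  have p2 := h0 2
  rw [Fin.monotone_iff_le_succ]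
  intro i
  fin_cases i <;> simp [schmidtSpectrum, pairIndex₂] <;> nlinarith

theorem conj_diagonal_submatrix {ι : Type*} [Fintype ι] [DecidableEq ι] (R : Matrix ι ι ℂ)
    (y : ι → ℂ) (e : ι ≃ ι) :
    R.submatrix id e * Matrix.diagonal (y ∘ e) * (R.submatrix id e)ᴴ =
      R * Matrix.diagonal y * Rᴴ := by
  ext i j
  rw [Matrix.mul_apply, Matrix.mul_apply]
  simp only [Matrix.mul_diagonal, Matrix.conjTranspose_apply, Matrix.submatrix_apply, id,
    Function.comp_apply]
  exact Equiv.sum_comp e fun k => R i k * y k * star (R j k)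

/-- The sufficient half of Hildebrand's criterion. For each ordered `s`, one of the two orders of
the middle pair `s 0 * s 2`, `s 1 * s 1` makes the diagonal arrangement the minimizing one. -/
theorem mem_APPT_of_posSemidef_hildebrand {R : Matrix (Fin 3 × Fin 3) (Fin 3 × Fin 3) ℂ}
    (hR : R ∈ Matrix.unitaryGroup _ ℂ) {x : Fin 9 → ℝ} (hx : Antitone x) (hx0 : ∀ i, 0 ≤ x i)
    (hx1 : ∑ i, x i = 1) (h1 : (hildebrandL1 x).PosSemidef) (h2 : (hildebrandL2 x).PosSemidef) :
    R * Matrix.diagonal (fun p => (x (pairIndex₁ p) : ℂ)) * Rᴴ ∈ APPT 3 3 := by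
  refine mem_APPT_of_sum_schmidtSpectrum_nonneg ⟨?_, ?_⟩ fun Q hQ s hs hs0 => ?_
  · refine Matrix.PosSemidef.mul_mul_conjTranspose_same
      (Matrix.posSemidef_diagonal_iff.2 fun p => ?_) R
    exact_mod_cast hx0 _
  · have hRR : Rᴴ * R = 1 := Matrix.mem_unitaryGroup_iff'.1 hR
    rw [Matrix.trace_mul_comm, ← Matrix.mul_assoc, hRR, Matrix.one_mul, Matrix.trace_diagonal,
      Equiv.sum_comp pairIndex₁ (fun i => (x i : ℂ))]
    exact_mod_cast hx1
  · rcases le_total (s 0 * s 2) (s 1 * s 1) with h | h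
    · have hle := sum_schmidtSpectrum_mul_le_diagVec hQ hR (antivary_comp_of_monotone pairIndex₁
        (monotone_schmidtSpectrum_comp_pairIndex₁ hs hs0 h) hx)
      have hq := (Matrix.posSemidef_iff_dotProduct_mulVec.1 h1).2 s
      rw [star_trivial, hildebrandL1_eq_pairMatrix, dotProduct_pairMatrix_mulVec] at hq
      exact le_trans (by linarith) hle
    · have hR' := Matrix.submatrix_mem_unitaryGroup hR (pairIndex₂.trans pairIndex₁.symm)
      have hle := sum_schmidtSpectrum_mul_le_diagVec hQ hR' (antivary_comp_of_monotone pairIndex₂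
        (monotone_schmidtSpectrum_comp_pairIndex₂ hs hs0 h) hx)
      have hq := (Matrix.posSemidef_iff_dotProduct_mulVec.1 h2).2 s
      rw [star_trivial, hildebrandL2_eq_pairMatrix, dotProduct_pairMatrix_mulVec] at hq
      have e := conj_diagonal_submatrix R (fun p => (x (pairIndex₁ p) : ℂ))
        (pairIndex₂.trans pairIndex₁.symm)
      have e' : ((fun p => (x (pairIndex₁ p) : ℂ)) ∘ (pairIndex₂.trans pairIndex₁.symm)) =
          fun p => (((x ∘ pairIndex₂) p : ℝ) : ℂ) := by
        funext p; simp
      rw [e'] at e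
      rw [e] at hle
      exact le_trans (by linarith) hle

/-! ### Plane rotations of an orthonormal basis -/

/-- Multiplication by the rotation taking `e_p` to the direction of `e_p + w • e_q`. -/
theorem exists_unitary_diagVec_rotation {Q : Matrix (Fin 3 × Fin 3) (Fin 3 × Fin 3) ℂ}
    (hQ : Q ∈ Matrix.unitaryGroup _ ℂ) {p q : Fin 3 × Fin 3} (hpq : p ≠ q) (w : ℂ) :
    ∃ Q' ∈ Matrix.unitaryGroup (Fin 3 × Fin 3) ℂ, ∀ M : Matrix _ _ ℂ, M.IsHermitian →
      diagVec Q' M = diagVec Q M +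
        ((Complex.normSq w * (diagVec Q M q - diagVec Q M p) + 2 * (w * (Qᴴ * M * Q) p q).re) /
          (1 + Complex.normSq w)) • (Pi.single p 1 - Pi.single q 1) := by
  have hw : 0 < 1 + Complex.normSq w := by have := Complex.normSq_nonneg w; linarith
  set c : ℝ := (√(1 + Complex.normSq w))⁻¹ with hc
  have hcc : c * c = (1 + Complex.normSq w)⁻¹ := by
    rw [hc, ← mul_inv, Real.mul_self_sqrt hw.le]
  have hcC : (c : ℂ) * c * (1 + w * (starRingEnd ℂ) w) = 1 := by
    have : w * (starRingEnd ℂ) w = (Complex.normSq w : ℂ) := Complex.mul_conj w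
    rw [this, ← Complex.ofReal_mul, hcc]
    have : (1 + (Complex.normSq w : ℂ)) ≠ 0 := by exact_mod_cast hw.ne'
    push_cast
    field_simp
  -- The columns of the rotation.
  set g : Fin 3 × Fin 3 → Fin 3 × Fin 3 → ℂ := fun j =>
    if j = p then (c : ℂ) • Pi.single p 1 + (c * w) • Pi.single q 1
    else if j = q then (-(c * star w)) • Pi.single p 1 + (c : ℂ) • Pi.single q 1
    else Pi.single j 1 with hg
  have hgp : g p = (c : ℂ) • Pi.single p 1 + (c * w) • Pi.single q 1 := by simp [hg]
  have hgq : g q = (-(c * star w)) • Pi.single p 1 + (c : ℂ) • Pi.single q 1 := by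
    simp [hg, hpq.symm]
  have hgo : ∀ j, j ≠ p → j ≠ q → g j = Pi.single j 1 := fun j h1 h2 => by simp [hg, h1, h2]
  set G : Matrix (Fin 3 × Fin 3) (Fin 3 × Fin 3) ℂ := Matrix.of fun i j => g j i with hG
  have hstar : ∀ j : Fin 3 × Fin 3, star (Pi.single j 1 : Fin 3 × Fin 3 → ℂ) = Pi.single j 1 := by
    intro j; rw [← Pi.single_star, star_one]
  have hent : ∀ (M : Matrix (Fin 3 × Fin 3) (Fin 3 × Fin 3) ℂ) j k,
      (Gᴴ * M * G) j k = star (g j) ⬝ᵥ (M *ᵥ g k) := by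
    intro M j k
    rw [Matrix.mul_assoc, Matrix.mul_apply]
    rfl
  have hGu : G ∈ Matrix.unitaryGroup (Fin 3 × Fin 3) ℂ := by
    rw [Matrix.mem_unitaryGroup_iff', Matrix.star_eq_conjTranspose]
    have h1 : Gᴴ * G = Gᴴ * 1 * G := by rw [Matrix.mul_one]
    ext j k
    rw [h1, hent, Matrix.one_mulVec, Matrix.one_apply]
    by_cases hjp : j = p
    · subst hjp
      by_cases hkp : k = j
      · subst hkp
        rw [hgp]
        simp [hstar, hpq, hpq.symm]
        linear_combination hcC
      · by_cases hkq : k = q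
        · subst hkq
          rw [hgp, hgq]
          simp [hstar, hpq, hpq.symm]
          ring
        · rw [hgp, hgo k hkp hkq]
          simp [hstar, hkp, hkq, Ne.symm hkp]
    · by_cases hjq : j = q
      · subst hjq
        by_cases hkp : k = p
        · subst hkp
          rw [hgp, hgq]
          simp [hstar, hpq, hpq.symm]
          ring
        · by_cases hkq : k = j
          · subst hkq
            rw [hgq]
            simp [hstar, hpq, hpq.symm]
            linear_combination hcC
          · rw [hgq, hgo k hkp hkq]
            simp [hstar, hkp, hkq, Ne.symm hkq]
      · rw [hgo j hjp hjq]
        by_cases hkp : k = p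
        · subst hkp
          rw [hgp]
          simp [hstar, hjp, hjq]
        · by_cases hkq : k = q
          · subst hkq
            rw [hgq]
            simp [hstar, hjp, hjq]
          · rw [hgo k hkp hkq]
            simp [hstar, Pi.single_apply, eq_comm]
  refine ⟨Q * G, mul_mem hQ hGu, fun M hM => ?_⟩
  have hN : (Qᴴ * M * Q).IsHermitian := Matrix.isHermitian_conjTranspose_mul_mul Q hM
  have hdv : ∀ j, diagVec (Q * G) M j = ((Gᴴ * (Qᴴ * M * Q) * G) j j).re := by
    intro j
    rw [diagVec, Matrix.conjTranspose_mul]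
    simp only [Matrix.mul_assoc]
  have hdQ : ∀ j, diagVec Q M j = ((Qᴴ * M * Q) j j).re := fun j => rfl
  generalize Qᴴ * M * Q = N at hN hdv hdQ ⊢
  have him : ∀ j, (N j j).im = 0 := fun j => Complex.conj_eq_iff_im.1 (hN.apply j j)
  have hqp : N q p = star (N p q) := (hN.apply q p).symm
  have hns : Complex.normSq w = w.re * w.re + w.im * w.im := Complex.normSq_apply w
  have hcc' : c * c * (1 + Complex.normSq w) = 1 := by rw [hcc]; field_simp
  funext j
  rw [hdv, hent, Pi.add_apply, Pi.smul_apply, smul_eq_mul, Pi.sub_apply, hdQ, hdQ, hdQ,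
    div_eq_mul_inv, ← hcc]
  by_cases hjp : j = p
  · subst hjp
    rw [hgp]
    simp [hstar, hpq, Matrix.mulVec_add, Matrix.mulVec_smul, him, hqp]
    rw [hns] at hcc' ⊢
    linear_combination (N j j).re * hcc'
  · by_cases hjq : j = q
    · subst hjq
      rw [hgq]
      simp [hstar, hpq.symm, Matrix.mulVec_add, Matrix.mulVec_neg, Matrix.mulVec_smul, him, hqp]
      rw [hns] at hcc' ⊢
      linear_combination (N j j).re * hcc'
    · rw [hgo j hjp hjq]
      simp [hstar, hjp, hjq]

theorem pairMatrix_add (y z : Fin 3 × Fin 3 → ℝ) :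
    pairMatrix (y + z) = pairMatrix y + pairMatrix z := by
  ext a b
  fin_cases a <;> fin_cases b <;> simp [pairMatrix] <;> ring

theorem pairMatrix_smul (r : ℝ) (y : Fin 3 × Fin 3 → ℝ) :
    pairMatrix (r • y) = r • pairMatrix y := by
  ext a b
  fin_cases a <;> fin_cases b <;> simp [pairMatrix] <;> ring

theorem pairMatrix_sub (y z : Fin 3 × Fin 3 → ℝ) :
    pairMatrix (y - z) = pairMatrix y - pairMatrix z := by
  ext a b
  fin_cases a <;> fin_cases b <;> simp [pairMatrix] <;> ring

theorem sum_schmidtSpectrum_mul_eq_zero {y : Fin 3 × Fin 3 → ℝ} {s : Fin 3 → ℝ}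
    (h : pairMatrix y *ᵥ s = 0) : ∑ p, schmidtSpectrum s p * y p = 0 := by
  have := dotProduct_pairMatrix_mulVec y s
  rw [h, dotProduct_zero] at this
  linarith

theorem pairMatrix_mulVec_eq_zero {y : Fin 3 × Fin 3 → ℝ} {s : Fin 3 → ℝ}
    (hy : (pairMatrix y).PosSemidef) (h : ∑ p, schmidtSpectrum s p * y p = 0) :
    pairMatrix y *ᵥ s = 0 := by
  rw [← hy.dotProduct_mulVec_zero_iff, star_trivial, dotProduct_pairMatrix_mulVec, h, mul_zero]

theorem eq_zero_of_forall_sq_mul_add_mul_nonneg {a b : ℝ} (h : ∀ r : ℝ, 0 ≤ r ^ 2 * a + r * b) :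
    b = 0 := by
  have := discrim_le_zero (a := a) (b := b) (c := 0) fun r => by have := h r; nlinarith
  rw [discrim] at this
  nlinarith

/-- If `σ` vanishes, in the sense of `pairMatrix _ *ᵥ s = 0`, in every orthonormal basis in which
`ρ` does, then the off-diagonal entries of `σ` vanish in an eigenbasis of `ρ`, as do the
differences of diagonal entries at equal eigenvalues. The exception is a pair `p`, `q` for which
exchanging the two coordinates does not affect `pairMatrix _ *ᵥ s`.

If the two values of `schmidtSpectrum s` differ, rotating the plane of `p` and `q` to first order
shows the off-diagonal entry to vanish; at equal eigenvalues all rotations leave `ρ` diagonal. -/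
theorem apply_eq_zero_of_pairMatrix_single_sub_single_ne_zero
    {ρ σ Q : Matrix (Fin 3 × Fin 3) (Fin 3 × Fin 3) ℂ} (hρ : ρ ∈ APPT 3 3) (hσ : σ ∈ APPT 3 3)
    {s : Fin 3 → ℝ} (hker : ∀ Q ∈ Matrix.unitaryGroup (Fin 3 × Fin 3) ℂ,
      pairMatrix (diagVec Q ρ) *ᵥ s = 0 → pairMatrix (diagVec Q σ) *ᵥ s = 0)
    (hQ : Q ∈ Matrix.unitaryGroup _ ℂ) {y : Fin 3 × Fin 3 → ℝ}
    (hy : Qᴴ * ρ * Q = Matrix.diagonal fun p => (y p : ℂ)) (hs : pairMatrix y *ᵥ s = 0)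
    {p q : Fin 3 × Fin 3} (hpq : p ≠ q)
    (hv : pairMatrix (Pi.single p 1 - Pi.single q 1) *ᵥ s ≠ 0) :
    (Qᴴ * σ * Q) p q = 0 ∧ (y p = y q → diagVec Q σ p = diagVec Q σ q) := by
  have hyd : diagVec Q ρ = y := by
    funext j; simp [diagVec, hy]
  have hσ0 : pairMatrix (diagVec Q σ) *ᵥ s = 0 := hker Q hQ (by rw [hyd, hs])
  choose Q' hQ' hd using exists_unitary_diagVec_rotation hQ hpq
  have hpos : ∀ w : ℂ, 0 < 1 + Complex.normSq w := fun w => by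
    have := Complex.normSq_nonneg w; linarith
  -- At equal eigenvalues every rotation preserves `diagVec _ ρ`.
  have tie : y p = y q → (Qᴴ * σ * Q) p q = 0 ∧ diagVec Q σ p = diagVec Q σ q := by
    intro hpe
    have hz : ∀ w : ℂ, Complex.normSq w * (diagVec Q σ q - diagVec Q σ p) +
        2 * (w * (Qᴴ * σ * Q) p q).re = 0 := by
      intro w
      have h1 : diagVec (Q' w) ρ = y := by
        rw [hd w ρ (APPT.isHermitian hρ), hyd, hy, hpe]
        simp [Matrix.diagonal_apply_ne _ hpq]
      have h2 := hker _ (hQ' w) (by rw [h1, hs])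
      rw [hd w σ (APPT.isHermitian hσ), pairMatrix_add, Matrix.add_mulVec, hσ0, zero_add,
        pairMatrix_smul, Matrix.smul_mulVec, smul_eq_zero, or_iff_left hv, div_eq_zero_iff,
        or_iff_left (hpos w).ne'] at h2
      exact h2
    have e1 := hz 1
    have e2 := hz (-1)
    have e3 := hz Complex.I
    simp at e1 e2 e3
    refine ⟨Complex.ext (by simp; linarith) (by simp; linarith), by linarith⟩
  by_cases hμ : schmidtSpectrum s p = schmidtSpectrum s q
  · -- The rotated `ρ` keeps its expectation zero, so positivity forces equal eigenvalues.
    have hpe : y p = y q := by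
      have h1 := hd 1 ρ (APPT.isHermitian hρ)
      rw [hyd, hy, Matrix.diagonal_apply_ne _ hpq] at h1
      have h2 : ∑ j, schmidtSpectrum s j * diagVec (Q' 1) ρ j = 0 := by
        rw [h1]
        simp only [Pi.add_apply, Pi.smul_apply, Pi.sub_apply, smul_eq_mul, mul_add,
          Finset.sum_add_distrib, sum_schmidtSpectrum_mul_eq_zero hs, mul_sub,
          Finset.sum_sub_distrib]
        simp [Pi.single_apply, hμ]
      have h3 := pairMatrix_mulVec_eq_zero (APPT.posSemidef_pairMatrix_diagVec hρ (hQ' 1)) h2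
      rw [h1, pairMatrix_add, Matrix.add_mulVec, hs, zero_add, pairMatrix_smul,
        Matrix.smul_mulVec, smul_eq_zero, or_iff_left hv] at h3
      simp at h3
      linarith
    exact ⟨(tie hpe).1, fun _ => (tie hpe).2⟩
  · refine ⟨?_, fun h => (tie h).2⟩
    have hμ' : schmidtSpectrum s p - schmidtSpectrum s q ≠ 0 := sub_ne_zero.2 hμ
    have hnn : ∀ w : ℂ, 0 ≤ (schmidtSpectrum s p - schmidtSpectrum s q) *
        (Complex.normSq w * (diagVec Q σ q - diagVec Q σ p) +
          2 * (w * (Qᴴ * σ * Q) p q).re) := by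
      intro w
      have h1 := APPT.sum_schmidtSpectrum_mul_diagVec_nonneg hσ (hQ' w) s
      rw [hd w σ (APPT.isHermitian hσ)] at h1
      generalize Complex.normSq w * (diagVec Q σ q - diagVec Q σ p) +
          2 * (w * (Qᴴ * σ * Q) p q).re = N at h1 ⊢
      simp only [Pi.add_apply, Pi.smul_apply, Pi.sub_apply, smul_eq_mul, mul_add,
        Finset.sum_add_distrib, sum_schmidtSpectrum_mul_eq_zero hσ0, mul_sub,
        Finset.sum_sub_distrib] at h1
      simp [Pi.single_apply] at h1
      have h2 : 0 ≤ (schmidtSpectrum s p - schmidtSpectrum s q) * (N / (1 + Complex.normSq w)) := by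
        linarith
      rw [← mul_div_assoc] at h2
      simpa [div_mul_cancel₀ _ (hpos w).ne'] using mul_nonneg h2 (hpos w).le
    have hre : (schmidtSpectrum s p - schmidtSpectrum s q) * (2 * ((Qᴴ * σ * Q) p q).re) = 0 :=
      eq_zero_of_forall_sq_mul_add_mul_nonneg
        (a := (schmidtSpectrum s p - schmidtSpectrum s q) * (diagVec Q σ q - diagVec Q σ p))
        fun r => by
          have := hnn (r : ℂ)
          simp [Complex.normSq_ofReal] at this
          linarith
    have him : (schmidtSpectrum s p - schmidtSpectrum s q) * (-2 * ((Qᴴ * σ * Q) p q).im) = 0 :=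
      eq_zero_of_forall_sq_mul_add_mul_nonneg
        (a := (schmidtSpectrum s p - schmidtSpectrum s q) * (diagVec Q σ q - diagVec Q σ p))
        fun r => by
          have := hnn (r * Complex.I)
          simp [Complex.normSq_ofReal] at this
          linarith
    have hre' := (mul_eq_zero.1 hre).resolve_left hμ'
    have him' := (mul_eq_zero.1 him).resolve_left hμ'
    exact Complex.ext (by simp; linarith) (by simp; linarith)

/-! ### Kernel vectors of the Hildebrand matrices -/

/-- Positive numbers indexed by pairs, ordered in the way common to the eigenvalue arrangements
`x ∘ pairIndex₁` and `x ∘ pairIndex₂` of a positive non-increasing `x`. -/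
structure PairOrdered (y : Fin 3 × Fin 3 → ℝ) : Prop where
  pos : ∀ p, 0 < y p
  le_20_10 : y (2, 0) ≤ y (1, 0)
  le_21_20 : y (2, 1) ≤ y (2, 0)
  le_22_21 : y (2, 2) ≤ y (2, 1)
  le_12_22 : y (1, 2) ≤ y (2, 2)
  le_02_12 : y (0, 2) ≤ y (1, 2)
  le_01_02 : y (0, 1) ≤ y (0, 2)

theorem pairOrdered_comp_pairIndex₁ {x : Fin 9 → ℝ} (hx : Antitone x) (h0 : ∀ i, 0 < x i) :
    PairOrdered (x ∘ pairIndex₁) :=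
  ⟨fun _ => h0 _, hx (by decide), hx (by decide), hx (by decide), hx (by decide), hx (by decide),
    hx (by decide)⟩

theorem pairOrdered_comp_pairIndex₂ {x : Fin 9 → ℝ} (hx : Antitone x) (h0 : ∀ i, 0 < x i) :
    PairOrdered (x ∘ pairIndex₂) :=
  ⟨fun _ => h0 _, hx (by decide), hx (by decide), hx (by decide), hx (by decide), hx (by decide),
    hx (by decide)⟩

theorem pairMatrix_mulVec_apply (y : Fin 3 × Fin 3 → ℝ) (s : Fin 3 → ℝ) :
    pairMatrix y *ᵥ s =
      ![2 * y (0, 0) * s 0 + (y (0, 1) - y (1, 0)) * s 1 + (y (0, 2) - y (2, 0)) * s 2,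
        (y (0, 1) - y (1, 0)) * s 0 + 2 * y (1, 1) * s 1 + (y (1, 2) - y (2, 1)) * s 2,
        (y (0, 2) - y (2, 0)) * s 0 + (y (1, 2) - y (2, 1)) * s 1 + 2 * y (2, 2) * s 2] := by
  funext a
  fin_cases a <;> simp [pairMatrix, Matrix.mulVec, dotProduct, Fin.sum_univ_three]

/-- A kernel vector has no zero coordinate except possibly the last; if the last one vanishes, then
the first two have equal signs and the five middle values agree. -/
theorem PairOrdered.kernel {y : Fin 3 × Fin 3 → ℝ} (hy : PairOrdered y) {s : Fin 3 → ℝ}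
    (hs : s ≠ 0) (h : pairMatrix y *ᵥ s = 0) :
    s 0 ≠ 0 ∧ s 1 ≠ 0 ∧ (s 2 = 0 → 0 < s 0 * s 1 ∧ y (2, 0) = y (2, 2) ∧ y (2, 1) = y (2, 2) ∧
      y (1, 2) = y (2, 2) ∧ y (0, 2) = y (2, 2)) := by
  rw [pairMatrix_mulVec_apply] at h
  have e0 := congrFun h 0
  have e1 := congrFun h 1
  have e2 := congrFun h 2
  simp at e0 e1 e2
  obtain ⟨hp, h1, h2, h3, h4, h5, h6⟩ := hy
  have p00 := hp (0, 0)
  have p11 := hp (1, 1)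
  have p22 := hp (2, 2)
  generalize y (0, 0) = y00 at *
  generalize y (0, 1) = y01 at *
  generalize y (0, 2) = y02 at *
  generalize y (1, 0) = y10 at *
  generalize y (1, 1) = y11 at *
  generalize y (1, 2) = y12 at *
  generalize y (2, 0) = y20 at *
  generalize y (2, 1) = y21 at *
  generalize y (2, 2) = y22 at *
  have hne : ¬ (s 0 = 0 ∧ s 1 = 0 ∧ s 2 = 0) := by
    rintro ⟨a0, a1, a2⟩
    exact hs (funext fun i => by fin_cases i <;> assumption)
  generalize s 0 = a at *
  generalize s 1 = b at *
  generalize s 2 = c at *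
  -- A kernel vector of `[[2m, -k], [-k, 2n]]` with `k ≥ 0` has coordinates of equal sign.
  have key : ∀ {m n u v k : ℝ}, 0 < m → 0 < n → 2 * m * u = k * v → 2 * n * v = k * u → 0 ≤ k →
      (u ≠ 0 ∨ v ≠ 0) → 0 < u * v ∧ 0 < k := by
    intro m n u v k hm hn e f hk huv
    have hku : k * (u * v) = 2 * m * (u * u) := by linear_combination -u * e
    have hu : u ≠ 0 := by
      rintro rfl
      have : v = 0 := by
        have : 2 * n * v = 0 := by linarith
        rcases mul_eq_zero.1 this with h | h
        · linarith
        · exact h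
      simp_all
    have hpos : 0 < k * (u * v) := by
      have : 0 < u * u := mul_self_pos.2 hu
      rw [hku]
      positivity
    have hk' : 0 < k := lt_of_le_of_ne hk (by rintro rfl; simp at hpos)
    exact ⟨(pos_iff_pos_of_mul_pos hpos).1 hk', hk'⟩
  refine ⟨?_, ?_, ?_⟩
  · rintro rfl
    have hbc : b ≠ 0 ∨ c ≠ 0 := by
      by_contra! hh; exact hne ⟨rfl, hh⟩
    obtain ⟨k1, k2⟩ := key (k := y21 - y12) p11 p22 (by linarith) (by linarith) (by linarith) hbc
    have : 0 < y10 - y01 := by linarith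
    have hz : (y10 - y01) * (b * b) + (y20 - y02) * (b * c) = 0 := by linear_combination -b * e0
    linarith [mul_nonneg (show 0 ≤ y20 - y02 by linarith) k1.le,
      mul_pos this (mul_self_pos.2 (show b ≠ 0 by rintro rfl; simp at k1))]
  · rintro rfl
    have hac : a ≠ 0 ∨ c ≠ 0 := by
      by_contra! hh; exact hne ⟨hh.1, rfl, hh.2⟩
    obtain ⟨k1, k2⟩ := key (k := y20 - y02) p00 p22 (by linarith) (by linarith) (by linarith) hac
    have : 0 < y10 - y01 := by linarith
    have hz : (y10 - y01) * (a * a) + (y21 - y12) * (a * c) = 0 := by linear_combination -a * e1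
    linarith [mul_nonneg (show 0 ≤ y21 - y12 by linarith) k1.le,
      mul_pos this (mul_self_pos.2 (show a ≠ 0 by rintro rfl; simp at k1))]
  · rintro rfl
    have hab : a ≠ 0 ∨ b ≠ 0 := by
      by_contra! hh; exact hne ⟨hh.1, hh.2, rfl⟩
    obtain ⟨k1, -⟩ := key (k := y10 - y01) p00 p11 (by linarith) (by linarith) (by linarith) hab
    have ha : 0 < a * a := mul_self_pos.2 (by rintro rfl; simp at k1)
    have : y20 - y02 = 0 := by
      have hz : (y20 - y02) * (a * a) + (y21 - y12) * (a * b) = 0 := by linear_combination -a * e2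
      have h7 := mul_nonneg (show 0 ≤ y21 - y12 by linarith) k1.le
      have h8 := mul_nonneg (show 0 ≤ y20 - y02 by linarith) ha.le
      have h9 : (y20 - y02) * (a * a) = 0 := by linarith
      exact (mul_eq_zero.1 h9).resolve_right ha.ne'
    refine ⟨k1, ?_, ?_, ?_, ?_⟩ <;> linarith

theorem pairMatrix_single_mulVec (s : Fin 3 → ℝ) (p : Fin 3 × Fin 3) (i : Fin 3) :
    (pairMatrix (Pi.single p 1) *ᵥ s) i = (if p.1 ≤ p.2 then 1 else -1) *
      ((if i = p.2 then s p.1 else 0) + if i = p.1 then s p.2 else 0) := by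
  rw [pairMatrix_mulVec_apply]
  obtain ⟨a, b⟩ := p
  fin_cases a <;> fin_cases b <;> fin_cases i <;> simp [two_mul]

set_option maxHeartbeats 1000000 in
/-- Let `s` be a kernel vector of `pairMatrix y`. Moving mass from the coordinate `q` of `y` to the
coordinate `p` destroys the kernel equation for `s`, unless `s` is proportional to `(1, 1, 0)` and
both coordinates belong to a group of middle ones on which `y` is constant; then `(2, 2)` belongs to
the same group, and moving mass between it and `p` or `q` does destroy the equation. -/
theorem PairOrdered.exchange {y : Fin 3 × Fin 3 → ℝ} (hy : PairOrdered y) {s : Fin 3 → ℝ}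
    (hs : s ≠ 0) (h : pairMatrix y *ᵥ s = 0) {p q : Fin 3 × Fin 3} (hpq : p ≠ q)
    (hz : pairMatrix (Pi.single p 1 - Pi.single q 1) *ᵥ s = 0) :
    p ≠ (2, 2) ∧ q ≠ (2, 2) ∧ y p = y (2, 2) ∧ y q = y (2, 2) ∧
      pairMatrix (Pi.single p 1 - Pi.single (2, 2) 1) *ᵥ s ≠ 0 ∧
      pairMatrix (Pi.single q 1 - Pi.single (2, 2) 1) *ᵥ s ≠ 0 := by
  obtain ⟨h0, h1, h2⟩ := hy.kernel hs h
  have hne : ∀ r : Fin 3 × Fin 3,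
      (pairMatrix (Pi.single r 1) *ᵥ s) 2 ≠ (pairMatrix (Pi.single (2, 2) 1) *ᵥ s) 2 →
      pairMatrix (Pi.single r 1 - Pi.single (2, 2) 1) *ᵥ s ≠ 0 := by
    intro r hr h'
    rw [pairMatrix_sub, Matrix.sub_mulVec, sub_eq_zero] at h'
    exact hr (congrFun h' 2)
  rw [pairMatrix_sub, Matrix.sub_mulVec, sub_eq_zero] at hz
  have e0 := congrFun hz 0
  have e1 := congrFun hz 1
  have e2 := congrFun hz 2
  simp only [pairMatrix_single_mulVec] at e0 e1 e2 hne
  obtain ⟨a, b⟩ := p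
  obtain ⟨c, d⟩ := q
  clear hz h hs hy
  -- The columns `pairMatrix (Pi.single r 1) *ᵥ s` of the pairs `r` are compared entrywise. A
  -- coincidence of two of them contradicts `s 0 ≠ 0`, `s 1 ≠ 0` or the sign of `s 0 * s 1`, or it
  -- requires `s 2 = 0`.
  fin_cases a <;> fin_cases b <;> fin_cases c <;> fin_cases d <;>
    first
    | exact absurd rfl hpq
    | (exfalso
       simp at e0 e1 e2
       first
       | exact h0 (by linarith)
       | exact h1 (by linarith)
       | (obtain ⟨hlt, -⟩ := h2 (by linarith)
          nlinarith [mul_self_pos.2 h1]))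
    | (simp at e0 e1 e2
       have hs2 : s 2 = 0 := by linarith
       obtain ⟨-, k1, k2, k3, k4⟩ := h2 hs2
       refine ⟨by decide, by decide, by assumption, by assumption, hne _ ?_, hne _ ?_⟩ <;>
         simp [h0, h1, hs2])

theorem Matrix.eq_mul_mul_transpose_of_orthogonal {n : ℕ} {A D U : Matrix (Fin n) (Fin n) ℝ}
    (hU : U ∈ Matrix.orthogonalGroup (Fin n) ℝ) (h : Uᵀ * A * U = D) : A = U * D * Uᵀ := by
  have hUU : U * Uᵀ = 1 := (Matrix.mem_orthogonalGroup_iff _ _).1 hU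
  rw [← h]
  calc A = (U * Uᵀ) * A * (U * Uᵀ) := by simp [hUU]
    _ = _ := by simp only [Matrix.mul_assoc]

/-- The matrix has rank at least two. Otherwise it would be a multiple of some `u uᵀ`; the product of
the off-diagonal entries of such a matrix is positive when the diagonal is, whereas here the three
off-diagonal entries are nonpositive. -/
theorem PairOrdered.pos_of_diagonalization {y : Fin 3 × Fin 3 → ℝ} (hy : PairOrdered y)
    {U : Matrix (Fin 3) (Fin 3) ℝ} (hU : U ∈ Matrix.orthogonalGroup (Fin 3) ℝ) {d : Fin 3 → ℝ}
    (hd0 : ∀ i, 0 ≤ d i) (hd : Antitone d) (h : Uᵀ * pairMatrix y * U = Matrix.diagonal d) :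
    0 < d 1 := by
  by_contra! hle
  have d1 : d 1 = 0 := le_antisymm hle (hd0 1)
  have d2 : d 2 = 0 := le_antisymm ((hd (by decide)).trans hle) (hd0 2)
  have hA := Matrix.eq_mul_mul_transpose_of_orthogonal hU h
  have hent : ∀ i j, pairMatrix y i j = d 0 * (U i 0 * U j 0) := by
    intro i j
    rw [hA, Matrix.mul_apply]
    simp [Matrix.mul_diagonal, Fin.sum_univ_three, d1, d2]
    ring
  have a00 := hent 0 0
  have a11 := hent 1 1
  have a22 := hent 2 2
  have a01 := hent 0 1
  have a02 := hent 0 2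
  have a12 := hent 1 2
  simp [pairMatrix] at a00 a11 a22 a01 a02 a12
  have p00 := hy.pos (0, 0)
  have p11 := hy.pos (1, 1)
  have p22 := hy.pos (2, 2)
  have h01 : d 0 * (U 0 0 * U 1 0) ≤ 0 := by
    linarith [hy.le_20_10, hy.le_21_20, hy.le_22_21, hy.le_12_22, hy.le_02_12, hy.le_01_02]
  have h02 : d 0 * (U 0 0 * U 2 0) ≤ 0 := by
    linarith [hy.le_21_20, hy.le_22_21, hy.le_12_22, hy.le_02_12]
  have h12 : d 0 * (U 1 0 * U 2 0) ≤ 0 := by linarith [hy.le_22_21, hy.le_12_22]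
  have hpos : 0 < (2 * y (0, 0)) * (2 * y (1, 1)) * (2 * y (2, 2)) := by positivity
  rw [a00, a11, a22] at hpos
  have hneg := mul_nonpos_of_nonneg_of_nonpos (mul_nonneg_of_nonpos_of_nonpos h01 h02) h12
  nlinarith

/-! ### Perturbations with a prescribed kernel -/

theorem Matrix.exists_abs_le_mul {n : ℕ} {M : Matrix (Fin n) (Fin n) ℝ} {d : Fin n → ℝ}
    (hd : ∀ i, 0 ≤ d i) (hM : ∀ i j, d i = 0 → M i j = 0) :
    ∃ K, 0 ≤ K ∧ ∀ i j, |M i j| ≤ K * d i := by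
  refine ⟨∑ i, ∑ j, |M i j| / d i, Finset.sum_nonneg fun i _ => Finset.sum_nonneg fun j _ =>
    div_nonneg (abs_nonneg _) (hd i), fun i j => ?_⟩
  rcases (hd i).eq_or_lt with h | h
  · simp [hM i j h.symm, ← h]
  · have h1 : |M i j| / d i ≤ ∑ i, ∑ j, |M i j| / d i :=
      (Finset.single_le_sum (f := fun j => |M i j| / d i)
        (fun j _ => div_nonneg (abs_nonneg _) (hd i)) (Finset.mem_univ j)).trans
      (Finset.single_le_sum (f := fun i => ∑ j, |M i j| / d i)
        (fun i _ => Finset.sum_nonneg fun j _ => div_nonneg (abs_nonneg _) (hd i))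
        (Finset.mem_univ i))
    exact (div_le_iff₀ h).1 h1

/-- A symmetric perturbation of a nonnegative diagonal matrix which vanishes on its kernel keeps it
positive semidefinite for small parameters. -/
theorem Matrix.eventually_posSemidef_diagonal_add_smul {n : ℕ} {M : Matrix (Fin n) (Fin n) ℝ}
    (hsymm : M.IsHermitian) {d : Fin n → ℝ} (hd : ∀ i, 0 ≤ d i)
    (hM : ∀ i j, d i = 0 → M i j = 0) :
    ∀ᶠ ε : ℝ in nhds 0, (Matrix.diagonal d + ε • M).PosSemidef := by
  obtain ⟨K, hK, hb⟩ := Matrix.exists_abs_le_mul hd hM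
  have hev : ∀ᶠ ε : ℝ in nhds 0, |ε| * (n * K) < 1 := by
    have : Filter.Tendsto (fun ε : ℝ => |ε| * (n * K)) (nhds 0) (nhds (|0| * (n * K))) :=
      (continuous_abs.mul continuous_const).tendsto 0
    rw [abs_zero, zero_mul] at this
    exact this.eventually (gt_mem_nhds one_pos)
  filter_upwards [hev] with ε hε
  refine Matrix.posSemidef_iff_dotProduct_mulVec.2 ⟨?_, fun x => ?_⟩
  · refine (Matrix.isHermitian_diagonal _).add ?_
    rw [Matrix.IsHermitian, Matrix.conjTranspose_smul, hsymm.eq, star_trivial]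
  have hMs : ∀ i j, M i j = M j i := fun i j => by simpa using hsymm.apply j i
  have hterm : ∀ i j, |x i * (M i j * x j)| ≤ K / 2 * (d i * x i ^ 2 + d j * x j ^ 2) := by
    intro i j
    have h1 := hb i j
    have h2 := hb j i
    rw [hMs j i] at h2
    have h3 : |x i * (M i j * x j)| = |M i j| * (|x i| * |x j|) := by
      rw [abs_mul, abs_mul]; ring
    have h4 : |x i| * |x j| ≤ (x i ^ 2 + x j ^ 2) / 2 := by
      have := two_mul_le_add_sq (|x i|) (|x j|)
      rw [sq_abs, sq_abs] at this
      linarith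
    rw [h3]
    calc |M i j| * (|x i| * |x j|) ≤ |M i j| * ((x i ^ 2 + x j ^ 2) / 2) :=
          mul_le_mul_of_nonneg_left h4 (abs_nonneg _)
      _ ≤ _ := by nlinarith [sq_nonneg (x i), sq_nonneg (x j)]
  have hsum : |∑ i, ∑ j, x i * (M i j * x j)| ≤ n * K * ∑ i, d i * x i ^ 2 := by
    calc |∑ i, ∑ j, x i * (M i j * x j)| ≤ ∑ i, ∑ j, |x i * (M i j * x j)| :=
          (Finset.abs_sum_le_sum_abs _ _).trans
            (Finset.sum_le_sum fun i _ => Finset.abs_sum_le_sum_abs _ _)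
      _ ≤ ∑ i, ∑ j, K / 2 * (d i * x i ^ 2 + d j * x j ^ 2) :=
          Finset.sum_le_sum fun i _ => Finset.sum_le_sum fun j _ => hterm i j
      _ = _ := by
          simp only [← Finset.mul_sum, Finset.sum_add_distrib, Finset.sum_const, Finset.card_univ,
            Fintype.card_fin, nsmul_eq_mul]
          have : ∑ i, d i * (n * x i ^ 2) = n * ∑ i, d i * x i ^ 2 := by
            rw [Finset.mul_sum]
            exact Finset.sum_congr rfl fun i _ => by ring
          rw [this]
          ring
  have hq : star x ⬝ᵥ ((Matrix.diagonal d + ε • M) *ᵥ x) =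
      ∑ i, d i * x i ^ 2 + ε * ∑ i, ∑ j, x i * (M i j * x j) := by
    rw [Matrix.add_mulVec, dotProduct_add, Matrix.smul_mulVec, dotProduct_smul, star_trivial,
      smul_eq_mul]
    congr 1
    · refine Finset.sum_congr rfl fun i _ => ?_
      rw [Matrix.mulVec_diagonal]; ring
    · simp only [dotProduct, Matrix.mulVec, Finset.mul_sum]
  rw [hq]
  have hS : 0 ≤ ∑ i, d i * x i ^ 2 :=
    Finset.sum_nonneg fun i _ => mul_nonneg (hd i) (sq_nonneg _)
  have h1 := mul_le_mul_of_nonneg_left hsum (abs_nonneg ε)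
  rw [← abs_mul] at h1
  have h2 := neg_abs_le (ε * ∑ i, ∑ j, x i * (M i j * x j))
  nlinarith

theorem Matrix.mulVec_col_of_diagonalization {n : ℕ} {A U : Matrix (Fin n) (Fin n) ℝ}
    (hU : U ∈ Matrix.orthogonalGroup (Fin n) ℝ) {d : Fin n → ℝ}
    (h : Uᵀ * A * U = Matrix.diagonal d) (i : Fin n) : A *ᵥ U.col i = d i • U.col i := by
  have hUU : Uᵀ * U = 1 := (Matrix.mem_orthogonalGroup_iff' _ _).1 hU
  have hAU : A * U = U * Matrix.diagonal d := by
    conv_lhs => rw [Matrix.eq_mul_mul_transpose_of_orthogonal hU h]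
    rw [Matrix.mul_assoc, hUU, Matrix.mul_one]
  funext k
  have := congrFun (congrFun hAU k) i
  rw [Matrix.mul_diagonal, Matrix.mul_apply] at this
  simpa [Matrix.mulVec, dotProduct, mul_comm] using this

theorem Matrix.eventually_posSemidef_add_smul {n : ℕ} {A B U : Matrix (Fin n) (Fin n) ℝ}
    (hB : B.IsHermitian) (hU : U ∈ Matrix.orthogonalGroup (Fin n) ℝ) {d : Fin n → ℝ}
    (hd : ∀ i, 0 ≤ d i) (h : Uᵀ * A * U = Matrix.diagonal d)
    (hker : ∀ i, d i = 0 → B *ᵥ U.col i = 0) :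
    ∀ᶠ ε : ℝ in nhds 0, (A + ε • B).PosSemidef := by
  have hsymm : (Uᵀ * B * U).IsHermitian := by
    rw [← Matrix.conjTranspose_eq_transpose_of_trivial]
    exact Matrix.isHermitian_conjTranspose_mul_mul U hB
  have hz : ∀ i j, d i = 0 → (Uᵀ * B * U) i j = 0 := by
    intro i j hi
    have h1 : (Uᵀ * B * U) j i = 0 := by
      have : (Uᵀ * B * U) j i = Uᵀ j ⬝ᵥ (B *ᵥ U.col i) := by
        rw [Matrix.mul_assoc, Matrix.mul_apply]; rfl
      rw [this, hker i hi, dotProduct_zero]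
    have := hsymm.apply i j
    rw [h1] at this
    simpa using this.symm
  filter_upwards [Matrix.eventually_posSemidef_diagonal_add_smul hsymm hd hz] with ε hε
  have hc := hε.mul_mul_conjTranspose_same U
  have e : A + ε • B = U * (Matrix.diagonal d + ε • (Uᵀ * B * U)) * Uᴴ := by
    rw [Matrix.conjTranspose_eq_transpose_of_trivial, Matrix.mul_add, Matrix.add_mul,
      ← Matrix.eq_mul_mul_transpose_of_orthogonal hU h, Matrix.mul_smul, Matrix.smul_mul,
      ← Matrix.eq_mul_mul_transpose_of_orthogonal hU rfl]
  rwa [e]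

theorem Matrix.det_eq_prod_of_diagonalization {n : ℕ} {A U : Matrix (Fin n) (Fin n) ℝ}
    (hU : U ∈ Matrix.orthogonalGroup (Fin n) ℝ) {d : Fin n → ℝ}
    (h : Uᵀ * A * U = Matrix.diagonal d) : A.det = ∏ i, d i := by
  have hUU : Uᵀ * U = 1 := (Matrix.mem_orthogonalGroup_iff' _ _).1 hU
  have h1 := congrArg Matrix.det hUU
  rw [Matrix.det_mul, Matrix.det_one] at h1
  rw [← Matrix.det_diagonal, ← h, Matrix.det_mul, Matrix.det_mul]
  linear_combination (-A.det) * h1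

theorem Matrix.PosSemidef.nonneg_of_diagonalization {n : ℕ} {A U : Matrix (Fin n) (Fin n) ℝ}
    (hA : A.PosSemidef) {d : Fin n → ℝ} (h : Uᵀ * A * U = Matrix.diagonal d) (i : Fin n) :
    0 ≤ d i := by
  have := hA.conjTranspose_mul_mul_same U
  rw [Matrix.conjTranspose_eq_transpose_of_trivial, h, Matrix.posSemidef_diagonal_iff] at this
  exact this i

theorem Matrix.col_ne_zero_of_orthogonal {n : ℕ} {U : Matrix (Fin n) (Fin n) ℝ}
    (hU : U ∈ Matrix.orthogonalGroup (Fin n) ℝ) (i : Fin n) : U.col i ≠ 0 := by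
  intro h0
  have h := congrFun (congrFun ((Matrix.mem_orthogonalGroup_iff' _ _).1 hU) i) i
  have : (Uᵀ * U) i i = U.col i ⬝ᵥ U.col i := rfl
  rw [this, h0, dotProduct_zero, Matrix.one_apply_eq] at h
  exact zero_ne_one h

section Diagonalization

variable {y : Fin 3 × Fin 3 → ℝ} {U : Matrix (Fin 3) (Fin 3) ℝ} {d : Fin 3 → ℝ}

theorem PairOrdered.eq_zero_of_det_eq_zero (hy : PairOrdered y)
    (hU : U ∈ Matrix.orthogonalGroup (Fin 3) ℝ) (hd0 : ∀ i, 0 ≤ d i) (hd : Antitone d)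
    (h : Uᵀ * pairMatrix y * U = Matrix.diagonal d) (hdet : (pairMatrix y).det = 0) :
    d 2 = 0 := by
  have h1 := hy.pos_of_diagonalization hU hd0 hd h
  have h0 : 0 < d 0 := h1.trans_le (hd (by decide))
  rw [Matrix.det_eq_prod_of_diagonalization hU h, Fin.prod_univ_three] at hdet
  simpa [h0.ne', h1.ne'] using hdet

theorem PairOrdered.pairMatrix_mulVec_col (hy : PairOrdered y)
    (hU : U ∈ Matrix.orthogonalGroup (Fin 3) ℝ) (hd0 : ∀ i, 0 ≤ d i) (hd : Antitone d)
    (h : Uᵀ * pairMatrix y * U = Matrix.diagonal d) (hdet : (pairMatrix y).det = 0) :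
    pairMatrix y *ᵥ U.col 2 = 0 := by
  rw [Matrix.mulVec_col_of_diagonalization hU h, hy.eq_zero_of_det_eq_zero hU hd0 hd h hdet,
    zero_smul]

/-- Since `pairMatrix y` has rank at least two, a direction `z` with `pairMatrix z` annihilating
the last eigenvector preserves positivity to both sides when the determinant is zero; when it is
positive, every direction does. -/
theorem PairOrdered.eventually_posSemidef (hy : PairOrdered y)
    (hU : U ∈ Matrix.orthogonalGroup (Fin 3) ℝ) (hd0 : ∀ i, 0 ≤ d i) (hd : Antitone d)
    (h : Uᵀ * pairMatrix y * U = Matrix.diagonal d) {z : Fin 3 × Fin 3 → ℝ}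
    (hz : 0 < (pairMatrix y).det ∨ pairMatrix z *ᵥ U.col 2 = 0) :
    ∀ᶠ ε : ℝ in nhds 0, (pairMatrix (y + ε • z)).PosSemidef := by
  simp only [pairMatrix_add, pairMatrix_smul]
  refine Matrix.eventually_posSemidef_add_smul (pairMatrix_isHermitian z) hU hd0 h fun i hi => ?_
  rcases hz with hz | hz
  · rw [Matrix.det_eq_prod_of_diagonalization hU h,
      Finset.prod_eq_zero (Finset.mem_univ i) hi] at hz
    exact absurd hz (lt_irrefl 0)
  · have h1 := hy.pos_of_diagonalization hU hd0 hd h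
    have h0 : 0 < d 0 := h1.trans_le (hd (by decide))
    fin_cases i
    · exact absurd hi h0.ne'
    · exact absurd hi h1.ne'
    · exact hz

end Diagonalization

/-! ### Segments through an absolutely PPT state -/

theorem diagVec_add (Q M N : Matrix (Fin 3 × Fin 3) (Fin 3 × Fin 3) ℂ) :
    diagVec Q (M + N) = diagVec Q M + diagVec Q N := by
  funext p
  simp [diagVec, Matrix.mul_add, Matrix.add_mul]

theorem diagVec_smul (r : ℝ) (Q M : Matrix (Fin 3 × Fin 3) (Fin 3 × Fin 3) ℂ) :
    diagVec Q (r • M) = r • diagVec Q M := by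
  funext p
  simp [diagVec]

/-- A kernel vector of a convex combination of positive semidefinite matrices is a kernel vector of
each of them. -/
theorem pairMatrix_diagVec_mulVec_eq_zero_of_mem_openSegment
    {ρ σ τ Q : Matrix (Fin 3 × Fin 3) (Fin 3 × Fin 3) ℂ} (hσ : σ ∈ APPT 3 3) (hτ : τ ∈ APPT 3 3)
    (h : ρ ∈ openSegment ℝ σ τ) (hQ : Q ∈ Matrix.unitaryGroup _ ℂ) {s : Fin 3 → ℝ}
    (hs : pairMatrix (diagVec Q ρ) *ᵥ s = 0) : pairMatrix (diagVec Q σ) *ᵥ s = 0 := by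
  obtain ⟨a, b, ha, hb, -, rfl⟩ := h
  have h1 := APPT.posSemidef_pairMatrix_diagVec hσ hQ
  have h2 := APPT.posSemidef_pairMatrix_diagVec hτ hQ
  have n1 := (Matrix.posSemidef_iff_dotProduct_mulVec.1 h1).2 s
  have n2 := (Matrix.posSemidef_iff_dotProduct_mulVec.1 h2).2 s
  rw [← h1.dotProduct_mulVec_zero_iff]
  have h3 := congrArg (fun v => star s ⬝ᵥ v) hs
  simp only [diagVec_add, diagVec_smul, pairMatrix_add, pairMatrix_smul, Matrix.add_mulVec,
    Matrix.smul_mulVec, dotProduct_add, dotProduct_smul, smul_eq_mul, dotProduct_zero] at h3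
  have h4 := mul_nonneg hb.le n2
  have h5 := mul_nonneg ha.le n1
  have h6 : a * (star s ⬝ᵥ pairMatrix (diagVec Q σ) *ᵥ s) = 0 := by linarith
  exact (mul_eq_zero.1 h6).resolve_left ha.ne'

theorem conjTranspose_submatrix_mul_mul_submatrix {ι : Type*} [Fintype ι] [DecidableEq ι]
    (Q M : Matrix ι ι ℂ) (e : ι ≃ ι) :
    (Q.submatrix id e)ᴴ * M * Q.submatrix id e = (Qᴴ * M * Q).submatrix e e := by
  ext i j
  simp [Matrix.mul_apply]

section Segment

variable {ρ σ Q : Matrix (Fin 3 × Fin 3) (Fin 3 × Fin 3) ℂ} {s : Fin 3 → ℝ}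
  {y : Fin 3 × Fin 3 → ℝ}

/-- An absolutely PPT state `σ` which vanishes wherever `ρ` does is diagonal in every eigenbasis of
`ρ`, with equal entries at equal eigenvalues. -/
theorem apply_eq_zero_of_kernel (hρ : ρ ∈ APPT 3 3) (hσ : σ ∈ APPT 3 3)
    (hker : ∀ Q ∈ Matrix.unitaryGroup (Fin 3 × Fin 3) ℂ,
      pairMatrix (diagVec Q ρ) *ᵥ s = 0 → pairMatrix (diagVec Q σ) *ᵥ s = 0)
    (hQ : Q ∈ Matrix.unitaryGroup _ ℂ) (hy : Qᴴ * ρ * Q = Matrix.diagonal fun p => (y p : ℂ))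
    (hyo : PairOrdered y) (hs0 : s ≠ 0) (hs : pairMatrix y *ᵥ s = 0)
    {p q : Fin 3 × Fin 3} (hpq : p ≠ q) :
    (Qᴴ * σ * Q) p q = 0 ∧ (y p = y q → diagVec Q σ p = diagVec Q σ q) := by
  by_cases hv : pairMatrix (Pi.single p 1 - Pi.single q 1) *ᵥ s = 0
  · obtain ⟨hp, hq, yp, yq, vp, vq⟩ := hyo.exchange hs0 hs hpq hv
    have tp := (apply_eq_zero_of_pairMatrix_single_sub_single_ne_zero hρ hσ hker hQ hy hs
      hp vp).2 yp
    have tq := (apply_eq_zero_of_pairMatrix_single_sub_single_ne_zero hρ hσ hker hQ hy hs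
      hq vq).2 yq
    refine ⟨?_, fun _ => tp.trans tq.symm⟩
    -- Exchange the basis vectors `q` and `(2, 2)` of one eigenspace.
    have hy' : (Q.submatrix id (Equiv.swap q (2, 2)))ᴴ * ρ * Q.submatrix id (Equiv.swap q (2, 2)) =
        Matrix.diagonal fun p => (y p : ℂ) := by
      rw [conjTranspose_submatrix_mul_mul_submatrix, hy, Matrix.submatrix_diagonal_equiv]
      congr 1
      funext r
      simp only [Function.comp_apply]
      rcases eq_or_ne r q with rfl | hr
      · rw [Equiv.swap_apply_left, yq]
      · rcases eq_or_ne r (2, 2) with rfl | hr'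
        · rw [Equiv.swap_apply_right, yq]
        · rw [Equiv.swap_apply_of_ne_of_ne hr hr']
    have h := (apply_eq_zero_of_pairMatrix_single_sub_single_ne_zero hρ hσ hker
      (Matrix.submatrix_mem_unitaryGroup hQ (Equiv.swap q (2, 2))) hy' hs hp vp).1
    rw [conjTranspose_submatrix_mul_mul_submatrix, Matrix.submatrix_apply,
      Equiv.swap_apply_of_ne_of_ne hpq hp, Equiv.swap_apply_right] at h
    exact h
  · exact apply_eq_zero_of_pairMatrix_single_sub_single_ne_zero hρ hσ hker hQ hy hs hpq hv

end Segment

theorem sum_diagVec {σ Q : Matrix (Fin 3 × Fin 3) (Fin 3 × Fin 3) ℂ} (hσ : IsState σ)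
    (hQ : Q ∈ Matrix.unitaryGroup _ ℂ) : ∑ p, diagVec Q σ p = 1 := by
  have hQQ : Q * Qᴴ = 1 := Matrix.mem_unitaryGroup_iff.1 hQ
  have h : (Qᴴ * σ * Q).trace = 1 := by
    rw [Matrix.trace_mul_comm, ← Matrix.mul_assoc, hQQ, Matrix.one_mul, hσ.2]
  have := congrArg Complex.re h
  rwa [Matrix.trace, Complex.re_sum, Complex.one_re] at this

theorem Matrix.eq_mul_mul_conjTranspose_of_unitary {ι : Type*} [Fintype ι] [DecidableEq ι]
    {A D Q : Matrix ι ι ℂ} (hQ : Q ∈ Matrix.unitaryGroup ι ℂ) (h : Qᴴ * A * Q = D) :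
    A = Q * D * Qᴴ := by
  have hQQ : Q * Qᴴ = 1 := Matrix.mem_unitaryGroup_iff.1 hQ
  rw [← h]
  calc A = (Q * Qᴴ) * A * (Q * Qᴴ) := by simp [hQQ]
    _ = _ := by simp only [Matrix.mul_assoc]

section Eigenbasis

variable {ρ σ τ Q : Matrix (Fin 3 × Fin 3) (Fin 3 × Fin 3) ℂ} {lam : Fin 9 → ℝ}

/-- The increments of the diagonal entries, in an eigenbasis of `ρ` listed along `pairIndex₁`, when
passing from `ρ` to `σ`. -/
def diagIncrement (Q σ : Matrix (Fin 3 × Fin 3) (Fin 3 × Fin 3) ℂ) (lam : Fin 9 → ℝ) (k : Fin 9) :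
    ℝ :=
  diagVec Q σ (pairIndex₁.symm k) - lam k

/-- The eigenbasis can be relisted along any arrangement `e` of the eigenvalues. -/
theorem exists_unitary_relisting (hQ : Q ∈ Matrix.unitaryGroup _ ℂ)
    (hy : Qᴴ * ρ * Q = Matrix.diagonal fun p => (lam (pairIndex₁ p) : ℂ))
    (e : Fin 3 × Fin 3 ≃ Fin 9) :
    ∃ R ∈ Matrix.unitaryGroup (Fin 3 × Fin 3) ℂ,
      (Rᴴ * ρ * R = Matrix.diagonal fun p => (((lam ∘ e) p : ℝ) : ℂ)) ∧
        ∀ σ, diagVec R σ = lam ∘ e + diagIncrement Q σ lam ∘ e := by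
  refine ⟨Q.submatrix id (e.trans pairIndex₁.symm), Matrix.submatrix_mem_unitaryGroup hQ _, ?_,
    fun σ => ?_⟩
  · rw [conjTranspose_submatrix_mul_mul_submatrix, hy, Matrix.submatrix_diagonal_equiv]
    congr 1
    funext p
    simp
  · funext p
    rw [diagVec, conjTranspose_submatrix_mul_mul_submatrix]
    simp [diagIncrement, diagVec]

theorem pairMatrix_diagIncrement_mulVec_eq_zero (hσ : σ ∈ APPT 3 3) (hτ : τ ∈ APPT 3 3)
    (h : ρ ∈ openSegment ℝ σ τ) (hQ : Q ∈ Matrix.unitaryGroup _ ℂ)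
    (hy : Qᴴ * ρ * Q = Matrix.diagonal fun p => (lam (pairIndex₁ p) : ℂ))
    (e : Fin 3 × Fin 3 ≃ Fin 9) {s : Fin 3 → ℝ} (hs : pairMatrix (lam ∘ e) *ᵥ s = 0) :
    pairMatrix (diagIncrement Q σ lam ∘ e) *ᵥ s = 0 := by
  obtain ⟨R, hR, hRy, hRσ⟩ := exists_unitary_relisting hQ hy e
  have hRρ : diagVec R ρ = lam ∘ e := by
    funext p
    simp [diagVec, hRy]
  have := pairMatrix_diagVec_mulVec_eq_zero_of_mem_openSegment hσ hτ h hR (s := s) (by rw [hRρ, hs])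
  rwa [hRσ, pairMatrix_add, Matrix.add_mulVec, hs, zero_add] at this

/-- A nonzero kernel vector forces the increments to respect the multiplicities, and to determine
the state. -/
theorem sumZeroAndTies_diagIncrement (hρ : ρ ∈ APPT 3 3) (hσ : σ ∈ APPT 3 3) (hτ : τ ∈ APPT 3 3)
    (h : ρ ∈ openSegment ℝ σ τ) (hQ : Q ∈ Matrix.unitaryGroup _ ℂ)
    (hy : Qᴴ * ρ * Q = Matrix.diagonal fun p => (lam (pairIndex₁ p) : ℂ))
    {e : Fin 3 × Fin 3 ≃ Fin 9} (he : PairOrdered (lam ∘ e)) {s : Fin 3 → ℝ} (hs0 : s ≠ 0)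
    (hs : pairMatrix (lam ∘ e) *ᵥ s = 0) :
    SumZeroAndTies lam (diagIncrement Q σ lam) ∧ (diagIncrement Q σ lam = 0 → σ = ρ) := by
  obtain ⟨R, hR, hRy, hRσ⟩ := exists_unitary_relisting hQ hy e
  have hRρ : diagVec R ρ = lam ∘ e := by
    funext p
    simp [diagVec, hRy]
  have key := fun p q (hpq : p ≠ q) => apply_eq_zero_of_kernel hρ hσ
    (fun Q hQ => pairMatrix_diagVec_mulVec_eq_zero_of_mem_openSegment hσ hτ h hQ) hR hRy he hs0 hs
    hpq
  refine ⟨⟨?_, fun k hk => ?_⟩, fun h0 => ?_⟩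
  · have h1 := sum_diagVec hσ.1 hR
    have h2 := sum_diagVec hρ.1 hR
    rw [hRσ] at h1
    rw [hRρ] at h2
    simp only [Pi.add_apply, Finset.sum_add_distrib, h2] at h1
    have h3 := Equiv.sum_comp e (diagIncrement Q σ lam)
    simp only [Function.comp_apply] at h1
    linarith
  · have hne : e.symm k.castSucc ≠ e.symm k.succ :=
      e.symm.injective.ne (Fin.castSucc_lt_succ (i := k)).ne
    have := (key _ _ hne).2 (by simpa using hk)
    rw [hRσ] at this
    simp only [Pi.add_apply, Function.comp_apply, Equiv.apply_symm_apply] at this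
    linarith
  · have hRσ' : Rᴴ * σ * R = Matrix.diagonal fun p => (((lam ∘ e) p : ℝ) : ℂ) := by
      ext p q
      rcases eq_or_ne p q with rfl | hpq
      · rw [Matrix.diagonal_apply_eq, ← ofReal_diagVec (APPT.isHermitian hσ), hRσ, h0]
        simp
      · rw [Matrix.diagonal_apply_ne _ hpq, (key p q hpq).1]
    rw [Matrix.eq_mul_mul_conjTranspose_of_unitary hR hRσ',
      ← Matrix.eq_mul_mul_conjTranspose_of_unitary hR hRy]

/-- An extreme point admits no nonzero direction along which the eigenvalues can be moved to both
sides within Hildebrand's criterion. -/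
theorem eq_zero_of_mem_extremePoints (hρ : ρ ∈ Set.extremePoints ℝ (APPT 3 3))
    (hQ : Q ∈ Matrix.unitaryGroup _ ℂ)
    (hy : Qᴴ * ρ * Q = Matrix.diagonal fun p => (lam (pairIndex₁ p) : ℂ))
    (hlam : Antitone lam) (hpos : ∀ i, 0 < lam i) {t : Fin 9 → ℝ} (ht : SumZeroAndTies lam t)
    (h1 : ∀ᶠ ε : ℝ in nhds 0, (pairMatrix (lam ∘ pairIndex₁ + ε • (t ∘ pairIndex₁))).PosSemidef)
    (h2 : ∀ᶠ ε : ℝ in nhds 0, (pairMatrix (lam ∘ pairIndex₂ + ε • (t ∘ pairIndex₂))).PosSemidef) :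
    t = 0 := by
  have hcont : ∀ k, Filter.Tendsto (fun ε : ℝ => lam k + ε * t k) (nhds 0) (nhds (lam k)) := by
    intro k
    have : Filter.Tendsto (fun ε : ℝ => lam k + ε * t k) (nhds 0) (nhds (lam k + 0 * t k)) :=
      (continuous_const.add (continuous_id.mul continuous_const)).tendsto 0
    rwa [zero_mul, add_zero] at this
  have h3 : ∀ᶠ ε : ℝ in nhds 0, ∀ k, 0 ≤ (lam + ε • t) k :=
    Filter.eventually_all.2 fun k =>
      ((hcont k).eventually (lt_mem_nhds (hpos k))).mono fun ε hε => hε.le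
  have h4 : ∀ᶠ ε : ℝ in nhds 0, Antitone (lam + ε • t) := by
    have : ∀ᶠ ε : ℝ in nhds 0, ∀ k : Fin 8, (lam + ε • t) k.succ ≤ (lam + ε • t) k.castSucc := by
      refine Filter.eventually_all.2 fun k => ?_
      rcases (hlam (Fin.castSucc_lt_succ (i := k)).le).eq_or_lt with heq | hlt
      · refine Filter.Eventually.of_forall fun ε => ?_
        simp [heq, ht.2 k heq.symm]
      · exact ((hcont _).eventually_lt (hcont _) hlt).mono fun ε hε => hε.le
    exact this.mono fun ε hε => Fin.antitone_iff_succ_le.2 hε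
  have hsum : ∑ i, lam i = 1 := by
    have h5 := sum_diagVec hρ.1.1 hQ
    have : diagVec Q ρ = lam ∘ pairIndex₁ := by
      funext p
      simp [diagVec, hy]
    rw [this] at h5
    rw [← h5]
    exact (Equiv.sum_comp pairIndex₁ lam).symm
  have hmem : ∀ᶠ ε : ℝ in nhds 0,
      Q * Matrix.diagonal (fun p => ((lam + ε • t) (pairIndex₁ p) : ℂ)) * Qᴴ ∈ APPT 3 3 := by
    filter_upwards [h1, h2, h3, h4] with ε e1 e2 e3 e4
    refine mem_APPT_of_posSemidef_hildebrand hQ e4 e3 ?_ ?_ ?_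
    · simp [Finset.sum_add_distrib, hsum, ← Finset.mul_sum, ht.1]
    · rw [hildebrandL1_eq_pairMatrix]; exact e1
    · rw [hildebrandL2_eq_pairMatrix]; exact e2
  have hneg : Filter.Tendsto (fun ε : ℝ => -ε) (nhds 0) (nhds 0) := by
    simpa using (continuous_neg (G := ℝ)).tendsto 0
  have hboth := (hmem.and (hneg.eventually hmem)).filter_mono
    (nhdsWithin_le_nhds (s := Set.Ioi (0 : ℝ)))
  obtain ⟨ε, ⟨m1, m2⟩, hε⟩ := (hboth.and self_mem_nhdsWithin).exists
  have hε0 : ε ≠ 0 := (Set.mem_Ioi.1 hε).ne'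
  have hρe := Matrix.eq_mul_mul_conjTranspose_of_unitary hQ hy
  have hseg : ρ ∈ openSegment ℝ
      (Q * Matrix.diagonal (fun p => ((lam + ε • t) (pairIndex₁ p) : ℂ)) * Qᴴ)
      (Q * Matrix.diagonal (fun p => ((lam + (-ε) • t) (pairIndex₁ p) : ℂ)) * Qᴴ) := by
    refine ⟨1 / 2, 1 / 2, by norm_num, by norm_num, by norm_num, ?_⟩
    rw [← smul_add, ← Matrix.add_mul, ← Matrix.mul_add, Matrix.diagonal_add, ← Matrix.smul_mul,
      ← Matrix.mul_smul, ← Matrix.diagonal_smul]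
    conv_rhs => rw [hρe]
    congr 3
    funext p
    simp
    ring
  have heq := hρ.2 m1 m2 hseg
  have hd := congrArg (diagVec Q) heq
  have hQQ : Qᴴ * Q = 1 := Matrix.mem_unitaryGroup_iff'.1 hQ
  have hc : Qᴴ * (Q * Matrix.diagonal (fun p => ((lam + ε • t) (pairIndex₁ p) : ℂ)) * Qᴴ) * Q =
      Matrix.diagonal (fun p => ((lam + ε • t) (pairIndex₁ p) : ℂ)) := by
    calc _ = (Qᴴ * Q) * Matrix.diagonal (fun p => ((lam + ε • t) (pairIndex₁ p) : ℂ)) *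
          (Qᴴ * Q) := by simp only [Matrix.mul_assoc]
      _ = _ := by rw [hQQ, Matrix.one_mul, Matrix.mul_one]
  funext k
  have hk := congrFun hd (pairIndex₁.symm k)
  rw [diagVec, diagVec, hc, hy] at hk
  simp only [Matrix.diagonal_apply_eq, Equiv.apply_symm_apply,
    Complex.ofReal_re, Pi.add_apply, Pi.smul_apply, smul_eq_mul] at hk
  simpa [hε0] using hk

end Eigenbasis

/-- A full rank state is unitarily equivalent to the diagonal matrix of its eigenvalues listed along
`pairIndex₁`; these are positive. -/
theorem IsState.exists_unitary_eq_diagonal_eigenvalueVector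
    {ρ : Matrix (Fin 3 × Fin 3) (Fin 3 × Fin 3) ℂ} (hρ : IsState ρ) (hrank : ρ.rank = 9) :
    Antitone (eigenvalueVector hρ.1.isHermitian) ∧ (∀ k, 0 < eigenvalueVector hρ.1.isHermitian k) ∧
      ∃ Q ∈ Matrix.unitaryGroup (Fin 3 × Fin 3) ℂ, Qᴴ * ρ * Q =
        Matrix.diagonal fun p => (eigenvalueVector hρ.1.isHermitian (pairIndex₁ p) : ℂ) := by
  have hH := hρ.1.isHermitian
  refine ⟨fun i j hij => hH.eigenvalues₀_antitone (by simpa using hij), fun k => ?_, ?_⟩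
  · set E : Fin (Fintype.card (Fin 3 × Fin 3)) ≃ Fin 3 × Fin 3 :=
      Fintype.equivOfCardEq (Fintype.card_fin _) with hE
    have hk : eigenvalueVector hρ.1.isHermitian k =
        hH.eigenvalues (E (Fin.cast (by simp) k)) := by
      simp [eigenvalueVector, Matrix.IsHermitian.eigenvalues, ← hE]
    rw [hk]
    refine lt_of_le_of_ne (hρ.1.eigenvalues_nonneg _) (Ne.symm ?_)
    have hcard := hH.rank_eq_card_non_zero_eigs
    rw [hrank] at hcard
    by_contra h0
    have := Fintype.card_subtype_lt (p := fun i => hH.eigenvalues i ≠ 0) (not_not.2 h0)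
    rw [← hcard] at this
    simp at this
  · exact hH.exists_unitary_eq_diagonal_comp (pairIndex₁.trans (finCongr (by simp)))

/-! ### The extremality criterion -/

theorem theorem4p4
    (ρ : Matrix (Fin 3 × Fin 3) (Fin 3 × Fin 3) ℂ)
    (hρ : IsBoundaryAPPT ρ) (hrank : ρ.rank = 9)
    (lam : Fin 9 → ℝ) (hlam : lam = eigenvalueVector (APPT.isHermitian hρ.1))
    (U V : Matrix (Fin 3) (Fin 3) ℝ)
    (hU : U ∈ Matrix.orthogonalGroup (Fin 3) ℝ) (hV : V ∈ Matrix.orthogonalGroup (Fin 3) ℝ)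
    (d₁ d₂ : Fin 3 → ℝ) (hd₁ : Antitone d₁) (hd₂ : Antitone d₂)
    (hUd : Uᵀ * hildebrandL1 lam * U = Matrix.diagonal d₁)
    (hVd : Vᵀ * hildebrandL2 lam * V = Matrix.diagonal d₂) :
    ((∀ i, 0 ≤ d₁ i) ∧ (∀ i, 0 ≤ d₂ i)) ∧
    ((hildebrandL1 lam).det = 0 → 0 < (hildebrandL2 lam).det →
      (ρ ∈ Set.extremePoints ℝ (APPT 3 3) ↔
        ∀ t : Fin 9 → ℝ, SumZeroAndTies lam t →
          hildebrandL1 t *ᵥ U.col 2 = 0 → t = 0)) ∧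
    (0 < (hildebrandL1 lam).det → (hildebrandL2 lam).det = 0 →
      (ρ ∈ Set.extremePoints ℝ (APPT 3 3) ↔
        ∀ t : Fin 9 → ℝ, SumZeroAndTies lam t →
          hildebrandL2 t *ᵥ V.col 2 = 0 → t = 0)) ∧
    ((hildebrandL1 lam).det = 0 → (hildebrandL2 lam).det = 0 →
      (ρ ∈ Set.extremePoints ℝ (APPT 3 3) ↔
        ∀ t : Fin 9 → ℝ, SumZeroAndTies lam t →
          hildebrandL1 t *ᵥ U.col 2 = 0 → hildebrandL2 t *ᵥ V.col 2 = 0 → t = 0)) := by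
  have hmem := hρ.1
  obtain ⟨hanti, hpos, Q, hQ, hy⟩ := hmem.1.exists_unitary_eq_diagonal_eigenvalueVector hrank
  rw [← hlam] at hanti hpos hy
  simp only [hildebrandL1_eq_pairMatrix, hildebrandL2_eq_pairMatrix] at hUd hVd ⊢
  have hy₁ := pairOrdered_comp_pairIndex₁ hanti hpos
  have hy₂ := pairOrdered_comp_pairIndex₂ hanti hpos
  have hpsd : ∀ e : Fin 3 × Fin 3 ≃ Fin 9, (pairMatrix (lam ∘ e)).PosSemidef := by
    intro e
    obtain ⟨R, hR, hRy, -⟩ := exists_unitary_relisting hQ hy e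
    have h := APPT.posSemidef_pairMatrix_diagVec hmem hR
    have hRρ : diagVec R ρ = lam ∘ e := by
      funext p
      simp [diagVec, hRy]
    rwa [hRρ] at h
  have h0₁ := (hpsd pairIndex₁).nonneg_of_diagonalization hUd
  have h0₂ := (hpsd pairIndex₂).nonneg_of_diagonalization hVd
  have hU0 := Matrix.col_ne_zero_of_orthogonal hU 2
  have hV0 := Matrix.col_ne_zero_of_orthogonal hV 2
  have hk₁ := hy₁.pairMatrix_mulVec_col hU h0₁ hd₁ hUd
  have hk₂ := hy₂.pairMatrix_mulVec_col hV h0₂ hd₂ hVd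
  have hev₁ := fun t : Fin 9 → ℝ => hy₁.eventually_posSemidef hU h0₁ hd₁ hUd (z := t ∘ pairIndex₁)
  have hev₂ := fun t : Fin 9 → ℝ => hy₂.eventually_posSemidef hV h0₂ hd₂ hVd (z := t ∘ pairIndex₂)
  refine ⟨⟨h0₁, h0₂⟩, fun e₁ e₂ => ⟨fun h t ht ht₁ => ?_, fun h => ⟨hmem, fun σ hσ τ hτ hs => ?_⟩⟩,
    fun e₁ e₂ => ⟨fun h t ht ht₂ => ?_, fun h => ⟨hmem, fun σ hσ τ hτ hs => ?_⟩⟩,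
    fun e₁ e₂ => ⟨fun h t ht ht₁ ht₂ => ?_, fun h => ⟨hmem, fun σ hσ τ hτ hs => ?_⟩⟩⟩
  · exact eq_zero_of_mem_extremePoints h hQ hy hanti hpos ht (hev₁ t (.inr ht₁)) (hev₂ t (.inl e₂))
  · obtain ⟨hties, heq⟩ := sumZeroAndTies_diagIncrement hmem hσ hτ hs hQ hy hy₁ hU0 (hk₁ e₁)
    exact heq (h _ hties (pairMatrix_diagIncrement_mulVec_eq_zero hσ hτ hs hQ hy _ (hk₁ e₁)))
  · exact eq_zero_of_mem_extremePoints h hQ hy hanti hpos ht (hev₁ t (.inl e₁)) (hev₂ t (.inr ht₂))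
  · obtain ⟨hties, heq⟩ := sumZeroAndTies_diagIncrement hmem hσ hτ hs hQ hy hy₂ hV0 (hk₂ e₂)
    exact heq (h _ hties (pairMatrix_diagIncrement_mulVec_eq_zero hσ hτ hs hQ hy _ (hk₂ e₂)))
  · exact eq_zero_of_mem_extremePoints h hQ hy hanti hpos ht (hev₁ t (.inr ht₁)) (hev₂ t (.inr ht₂))
  · obtain ⟨hties, heq⟩ := sumZeroAndTies_diagIncrement hmem hσ hτ hs hQ hy hy₁ hU0 (hk₁ e₁)
    exact heq (h _ hties (pairMatrix_diagIncrement_mulVec_eq_zero hσ hτ hs hQ hy _ (hk₁ e₁))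
      (pairMatrix_diagIncrement_mulVec_eq_zero hσ hτ hs hQ hy _ (hk₂ e₂)))
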